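/- Let $k$ be a field and let $R$ be a discrete valuation ring which is a $k$-algebra, with maximal ideal $XR$ and such that $k\to R/XR$ is an isomorphism. Let $\alpha$ be a $k$-algebra automorphism of $R$ of infinite order. Let $S=R[\theta;\alpha]$ be the skew polynomial ring, with $\theta r=\alpha(r)\theta$ for $r\in R$, and let $T=Q[\theta;\alpha]$, where $Q$ is the quotient field of $R$; thus $T$ is the localisation of $S$ at $\mathcal X=\{X^n:n\ge 0\}$. All modules are right modules. An element of a ring is irreducible if it is a nonzero non-unit which is not a product of two non-units. An irreducible element $z$ of $S$ is of type (B) if, after multiplication by a unit of $S$, it has the form $1+Xs$ with $s\in S\setminus R$. Elements $a,b\in T$ are similar if there is a nonzero $u\in T$ with $uT+bT=T$ and $uaT=uT\cap bT$. An $S$-module is $\mathcal X$-torsion if each of its elements is annihilated by some power of $X$. **Theorem.** (1) Let $V$ be a faithful simple $S$-module. Then there is $z\in S$ such that (a) $z$ is irreducible in both $S$ and $T$; and (b) $V\cong S/zS\cong T/zT$ as $S$-modules. Moreover, any $z\in S$ satisfying (b) also satisfies (c): $z$ is a type (B) irreducible element of $S$. (2) Conversely, if $z\in S$ satisfies (a)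 and (c), then $S/zS\cong T/zT$ as $S$-modules, and this is a faithful simple $S$-module. (3) Let $z\in S$ satisfy (a) and (c), and let $y\in S\setminus XS$. The following are equivalent: (i) $S/zS\cong S/yS$ as $S$-modules; (ii) $T/zT\cong T/yT$ as $T$-modules; (iii) $z$ and $y$ are similar in $T$. Moreover, when these hold, $y$ is a type (B) irreducible element of $S$. (4) A simple $S$-module is not faithful if and only if it is $\mathcal X$-torsion. Up to isomorphism, the simple $S$-modules which are not faithful are exactly the modules $V_f=S/(XS+fS)$, where $f\in k[\theta]$ is a monic irreducible polynomial; and for monic irreducible $f,g\in k[\theta]$, $V_f\cong V_g$ if and only if $f=g$. -/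

import Mathlib

open Polynomial

noncomputable section

/-- The action of `ℕ` (written multiplicatively) on `A` in which `n` acts as `σ ^ n`. -/
abbrev skewAction {A : Type*} [Ring A] (σ : A ≃+* A) :
    MulSemiringAction (Multiplicative ℕ) A :=
  MulSemiringAction.compHom A (powersHom (RingAut A) σ)

/-- The skew polynomial ring `A[θ; σ]`: left coefficients, and `θ a = σ(a) θ`. -/
def SkewPoly {A : Type*} [Ring A] (_σ : A ≃+* A) : Type _ := SkewPolynomial A

namespace SkewPoly

variable {A : Type*} [Ring A] {B : Type*} [Ring B]

instance instRing (σ : A ≃+* A) : Ring (SkewPoly σ) :=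
  letI := skewAction σ
  inferInstanceAs (Ring (SkewPolynomial A))

/-- The inclusion of the coefficient ring, `A → A[θ; σ]`. -/
def C (σ : A ≃+* A) : A →+* SkewPoly σ :=
  letI := skewAction σ
  (SkewPolynomial.CRingHom : A →+* SkewPolynomial A)

/-- The variable `θ` of `A[θ; σ]`. -/
def θ (σ : A ≃+* A) : SkewPoly σ := (SkewPolynomial.X : SkewPolynomial A)

theorem θ_mul_C (σ : A ≃+* A) (a : A) : θ σ * C σ a = C σ (σ a) * θ σ := by
  let _ := skewAction σ
  have h : (SkewPolynomial.X : SkewPolynomial A) * SkewPolynomial.C a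
      = SkewPolynomial.C (σ a) * SkewPolynomial.X := by
    rw [← SkewPolynomial.monomial_zero_left, SkewPolynomial.X_mul_monomial,
      ← SkewPolynomial.monomial_zero_left, SkewPolynomial.monomial_mul_X]
    rfl
  exact h

theorem θ_pow_mul_C (σ : A ≃+* A) (n : ℕ) (a : A) :
    θ σ ^ n * C σ a = C σ ((σ ^ n : RingAut A) a) * θ σ ^ n := by
  induction n generalizing a with
  | zero => simp
  | succ n ih =>
    rw [pow_succ, mul_assoc, θ_mul_C, ← mul_assoc, ih, mul_assoc, pow_succ σ n]
    rfl

/-- For `f : A → B` with `f ∘ σ = τ ∘ f`, the ring homomorphism `A[θ; σ] → B[θ; τ]` that applies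
`f` to the coefficients and fixes `θ`. -/
def map (σ : A ≃+* A) (τ : B ≃+* B) (f : A →+* B) (h : ∀ a, f (σ a) = τ (f a)) :
    SkewPoly σ →+* SkewPoly τ :=
  letI := skewAction σ
  (SkewMonoidAlgebra.liftNCRingHom ((C τ).comp f) (powersHom (SkewPoly τ) (θ τ)) (by
    intro x y
    have key : ∀ n : ℕ, f ((σ ^ n : RingAut A) x) = (τ ^ n : RingAut B) (f x) := by
      intro n
      induction n with
      | zero => rfl
      | succ n ih =>
        rw [pow_succ', pow_succ']
        change f (σ ((σ ^ n : RingAut A) x)) = τ ((τ ^ n : RingAut B) (f x))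
        rw [h, ih]
    change C τ (f ((σ ^ (y.toAdd) : RingAut A) x)) * θ τ ^ (y.toAdd) = θ τ ^ (y.toAdd) * C τ (f x)
    rw [key, θ_pow_mul_C]) : SkewPolynomial A →+* SkewPoly τ)

theorem ind (σ : A ≃+* A) {p : SkewPoly σ → Prop}
   (h0 : p 0) (h1 : ∀ n a, p (C σ a * θ σ ^ n)) (ha : ∀ f g, p f → p g → p (f+g)) (f) : p f := by
  let _ := skewAction σ
  refine SkewMonoidAlgebra.induction_on (k := A) (G := Multiplicative ℕ) (p := p) f h0 ?_ ha
  intro g a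
  have := h1 g.toAdd a
  have e : (SkewPolynomial.C a * SkewPolynomial.X ^ g.toAdd : SkewPolynomial A) = SkewMonoidAlgebra.single g a :=
    @SkewPolynomial.C_mul_X_pow_eq_monomial A _ a (skewAction σ) g.toAdd
  rw [← e]; exact this

theorem coeff_term (σ : A ≃+* A) (a : A) (m n : ℕ) :
    SkewPolynomial.coeff (R := A) (C σ a * θ σ ^ m) n = if m = n then a else 0 :=
  (congrArg (fun p => SkewPolynomial.coeff (R := A) p n)
    (@SkewPolynomial.C_mul_X_pow_eq_monomial A _ a (skewAction σ) m)).trans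
    SkewPolynomial.coeff_monomial

theorem coeff_add' (σ : A ≃+* A) (f g : SkewPoly σ) (n : ℕ) :
    SkewPolynomial.coeff (R := A) (f + g) n =
      SkewPolynomial.coeff (R := A) f n + SkewPolynomial.coeff (R := A) g n :=
  congrFun (congrArg DFunLike.coe (SkewMonoidAlgebra.coeff_add (k := A) (G := Multiplicative ℕ) f g)) (Multiplicative.ofAdd n)

end SkewPoly

section RightModules

variable {D : Type*} [Ring D]

/-- The right ideal `z D` of `D`; right `D`-modules are modules over `Dᵐᵒᵖ`. -/
abbrev rightIdeal (z : D) : Submodule Dᵐᵒᵖ D := Submodule.span Dᵐᵒᵖ {z}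

/-- `a` is (right) similar to `b` in `D`: for some nonzero `u`, `u D + b D = D` (so `1` is the
highest common left factor of `u` and `b`), and `u a D = u D ∩ b D` (so `u a` is the least common
right multiple of `u` and `b`). -/
def IsSimilar (a b : D) : Prop :=
  ∃ u : D, u ≠ 0 ∧ rightIdeal u ⊔ rightIdeal b = ⊤ ∧
    rightIdeal (u * a) = rightIdeal u ⊓ rightIdeal b

end RightModules

section Setting

variable {k : Type*} [Field k] {R : Type*} [CommRing R] [IsDomain R] [Algebra k R]

/-- The ring `S = R[θ; α]`. -/
abbrev SRing (α : R ≃ₐ[k] R) : Type _ := SkewPoly (α : R ≃+* R)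

/-- The extension of `α` to the quotient field `Q` of `R`. -/
def extQ (α : R ≃ₐ[k] R) : FractionRing R ≃+* FractionRing R :=
  IsFractionRing.ringEquivOfRingEquiv (α : R ≃+* R)

/-- The ring `T = Q[θ; α]`, where `Q` is the quotient field of `R`. -/
abbrev TRing (α : R ≃ₐ[k] R) : Type _ := SkewPoly (extQ α)

/-- The element `x` of `R`, regarded as an element of `S`. -/
abbrev inS (α : R ≃ₐ[k] R) (x : R) : SRing α := SkewPoly.C (α : R ≃+* R) x

/-- The inclusion `S → T`. For a uniformizer `x` of `R` it exhibits `T` as the localisation of `S` at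
`{1, x, x², …}`: see `toT_injective`, `isUnit_toT_inS` and `exists_mul_pow_eq_toT` below. -/
def toT (α : R ≃ₐ[k] R) : SRing α →+* TRing α :=
  SkewPoly.map (α : R ≃+* R) (extQ α) (algebraMap R (FractionRing R)) (fun a => by
    simp [extQ])

theorem toT_C (α : R ≃ₐ[k] R) (a : R) :
    toT α (SkewPoly.C (α : R ≃+* R) a) = SkewPoly.C (extQ α) (algebraMap R (FractionRing R) a) := by
  let _ := skewAction (α : R ≃+* R)
  refine (SkewMonoidAlgebra.liftNC_single _ _ _ _).trans ?_
  simp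

theorem toT_θ (α : R ≃ₐ[k] R) :
    toT α (SkewPoly.θ (α : R ≃+* R)) = SkewPoly.θ (extQ α) := by
  let _ := skewAction (α : R ≃+* R)
  refine (SkewMonoidAlgebra.liftNC_single _ _ _ _).trans ?_
  simp

theorem toT_injective (α : R ≃ₐ[k] R) : Function.Injective (toT α) := by
  have key : ∀ (p : SRing α) (n : ℕ), SkewPolynomial.coeff (R := FractionRing R) (toT α p) n
      = algebraMap R (FractionRing R) (SkewPolynomial.coeff (R := R) p n) := by
    intro p n
    induction p using SkewPoly.ind with
    | h0 => rw [map_zero]; exact (map_zero _).symm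
    | h1 m a =>
      rw [map_mul, map_pow, toT_C, toT_θ, SkewPoly.coeff_term, SkewPoly.coeff_term]
      split_ifs <;> simp
    | ha f g hf hg =>
      rw [map_add, SkewPoly.coeff_add', SkewPoly.coeff_add', hf, hg, map_add]
  intro p q h
  have : ∀ n, SkewPolynomial.coeff (R := R) p n = SkewPolynomial.coeff (R := R) q n := fun n =>
    IsFractionRing.injective R (FractionRing R) (by rw [← key, ← key, h])
  apply SkewMonoidAlgebra.ext
  intro a
  exact this a.toAdd

theorem isUnit_toT_inS (α : R ≃ₐ[k] R) (x : R) (hx : x ≠ 0) : IsUnit (toT α (inS α x)) := by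
  rw [inS, toT_C]
  refine IsUnit.map _ (IsUnit.mk0 _ ?_)
  simpa using hx

theorem exists_mul_pow_eq_toT [IsDiscreteValuationRing R] (α : R ≃ₐ[k] R) (x : R)
   (hx : IsLocalRing.maximalIdeal R = Ideal.span {x}) (t : TRing α) :
   ∃ (n : ℕ) (s : SRing α), t * toT α (inS α x) ^ n = toT α s := by
  have hirr : Irreducible x := (IsDiscreteValuationRing.irreducible_iff_uniformizer x).2 hx
  induction t using SkewPoly.ind with
  | h0 => exact ⟨0, 0, by simp⟩
  | h1 m a =>
    obtain ⟨b, c, hc, rfl⟩ := IsFractionRing.div_surjective (A := R) a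
    have hc0 := nonZeroDivisors.ne_zero hc
    have hc' : algebraMap R (FractionRing R) c ≠ 0 := by simpa using hc0
    obtain ⟨n, u, hu⟩ := IsDiscreteValuationRing.eq_unit_mul_pow_irreducible hc0 hirr
    have h2 : ∀ m : ℕ, ∃ v : Rˣ, ((extQ α)^m : RingAut _) (algebraMap R (FractionRing R) x) = algebraMap R (FractionRing R) (v * x) := by
      intro m
      have hz : ∀ r : R, ((extQ α)^m : RingAut _) (algebraMap R (FractionRing R) r) = algebraMap R (FractionRing R) ((α ^ m) r) := by
        intro r
        induction m generalizing r with
        | zero => rfl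
        | succ m ih =>
          rw [pow_succ, pow_succ]
          change ((extQ α)^m : RingAut _) (extQ α (algebraMap R (FractionRing R) r)) = _
          have : extQ α (algebraMap R (FractionRing R) r) = algebraMap R _ (α r) := by simp [extQ]
          rw [this, ih]; rfl
      rw [hz]
      have : Irreducible ((α^m) x) := (MulEquiv.irreducible_iff (α^m)).2 hirr
      obtain ⟨v, hv⟩ := IsDiscreteValuationRing.associated_of_irreducible R hirr this
      exact ⟨v, by rw [← hv, mul_comm]⟩
    obtain ⟨v, hv⟩ := h2 m
    refine ⟨n, inS α (b * (↑(u⁻¹) : R) * (v:R)^n) * SkewPoly.θ _ ^ m, ?_⟩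
    rw [map_mul, map_pow, toT_θ, inS, inS, toT_C, toT_C, ← map_pow, mul_assoc, SkewPoly.θ_pow_mul_C, map_pow, hv,
      ← mul_assoc, ← map_mul]
    congr 2
    rw [div_mul_eq_mul_div, div_eq_iff hc', ← map_pow, ← map_mul, ← map_mul]
    congr 1
    rw [hu]
    have := u.inv_mul
    linear_combination (-(b * v^n*x^n)) * this
  | ha f g hf hg =>
    obtain ⟨n, s, h1⟩ := hf
    obtain ⟨m, r, h2⟩ := hg
    refine ⟨n + m, s * inS α x ^ m + r * inS α x ^ n, ?_⟩
    rw [map_add, map_mul, map_mul, ← h1, ← h2, map_pow, map_pow, add_mul, mul_assoc, mul_assoc, ← pow_add, ← pow_add, add_comm m n]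
/-- Factor modules of the right `T`-module `T` are right `S`-modules by restriction of scalars
along `S → T`. -/
instance quotientModuleS (α : R ≃ₐ[k] R) (I : Submodule (TRing α)ᵐᵒᵖ (TRing α)) :
    Module (SRing α)ᵐᵒᵖ (TRing α ⧸ I) :=
  Module.compHom (TRing α ⧸ I) (toT α).op

/-- The inclusion `k[θ] → S`. -/
def polyToS (α : R ≃ₐ[k] R) (f : k[X]) : SRing α :=
  f.eval₂ ((SkewPoly.C (α : R ≃+* R)).comp (algebraMap k R)) (SkewPoly.θ (α : R ≃+* R))

/-- Type **(B)** irreducible elements of `S`: irreducible elements that, after multiplication by a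
unit of `S`, have the form `1 + x s` with `s ∈ S \ R`. -/
def IsTypeB (α : R ≃ₐ[k] R) (x : R) (z : SRing α) : Prop :=
  Irreducible z ∧ ∃ (u : (SRing α)ˣ) (s : SRing α),
    s ∉ Set.range (inS α) ∧ (u : SRing α) * z = 1 + inS α x * s

/-- A right `S`-module `V` is torsion with respect to `{1, x, x², …}`. -/
def IsXTorsion (α : R ≃ₐ[k] R) (x : R) (V : Type*) [AddCommGroup V] [Module (SRing α)ᵐᵒᵖ V] :
    Prop :=
  ∀ v : V, ∃ n : ℕ, MulOpposite.op (inS α x ^ n) • v = 0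

/-- The right `S`-module `V_f = S / (x S + f S)`, for `f ∈ k[θ]`. -/
abbrev VMod (α : R ≃ₐ[k] R) (x : R) (f : k[X]) : Type _ :=
  SRing α ⧸ (rightIdeal (inS α x) ⊔ rightIdeal (polyToS α f))

end Setting

end

/-!
The element `x` is normal in `S`, and `S / x S` is the commutative polynomial ring `k[X]`, because
`α` induces the identity on the residue field `k`; the quotient map is `red`. A normal element acts
on a simple module as zero or bijectively
(`IsNormalElement.smul_eq_zero_or_bijective`), and this dichotomy for `x` separates the simple
`S`-modules into those which are not faithful and those which are.

If `V` is simple and not faithful, an element of least degree in its annihilator is a monomial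
`a θⁿ`, because `α` has infinite order (`SkewPoly.exists_term_of_not_faithfulSMul`). As `θ` is
normal too, either `x` or `θ` kills `V`; in the second case `V` is a simple `R`-module, hence also
killed by `x`. So `V` is a simple `k[X]`-module, that is, some `V_f` (`exists_VMod_equiv`).

If `V` is simple and faithful, `x` acts bijectively, and the annihilator in `T` of a nonzero `v` is
a right ideal of the right principal ideal ring `T`, hence of the form `z T` with `z` in `S`
outside `x S`. Since `x S` is completely prime, `z T ∩ S = z S` (`toT_mem_rightIdeal_iff`), whence
`V ≃ S / z S`. Surjectivity of `x` on `S / z S` means that `red z` is a unit of `k[X]`, that is, a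
nonzero constant, and for irreducible `z` this is equivalent to type (B)
(`IsTypeB.isUnit_red`, `isTypeB_of_isUnit_red`). Conversely, if `red z` is a unit then
`S = z S + S xⁿ` for all `n`, which makes `S / z S → T / z T` an isomorphism and, if `z` is
irreducible in `T`, makes `S / z S` simple and faithful. Finally, `S`-linear isomorphisms between
factor modules of `T` are `T`-linear, and a `T`-linear isomorphism `T / z T ≃ T / y T` is induced by
left multiplication by an element `u` as in the definition of similarity (`nonempty_quotient_equiv_iff_isSimilar`).
-/

noncomputable section

/-! ### Coefficients and degrees of skew polynomials -/

namespace SkewPoly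

variable {A : Type*} [Ring A]

/-- The `n`-th left coefficient of a skew polynomial, as an additive map. -/
def coeffHom (σ : A ≃+* A) (n : ℕ) : SkewPoly σ →+ A where
  toFun p := SkewPolynomial.coeff (R := A) p n
  map_zero' := rfl
  map_add' p q := coeff_add' σ p q n

variable {σ : A ≃+* A}

theorem coeffHom_term (a : A) (m n : ℕ) :
    coeffHom σ n (C σ a * θ σ ^ m) = if m = n then a else 0 :=
  coeff_term σ a m n

theorem ext_coeffHom {p q : SkewPoly σ} (h : ∀ n, coeffHom σ n p = coeffHom σ n q) : p = q :=
  SkewMonoidAlgebra.ext fun a => h a.toAdd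

theorem coeffHom_C (a : A) (n : ℕ) : coeffHom σ n (C σ a) = if 0 = n then a else 0 := by
  simpa using coeffHom_term (σ := σ) a 0 n

theorem term_mul_term (a b : A) (m n : ℕ) :
    C σ a * θ σ ^ m * (C σ b * θ σ ^ n) = C σ (a * (σ ^ m : RingAut A) b) * θ σ ^ (m + n) := by
  rw [mul_assoc, ← mul_assoc (θ σ ^ m), θ_pow_mul_C, map_mul, pow_add]
  simp only [mul_assoc]

theorem coeffHom_mul (p q : SkewPoly σ) (n : ℕ) :
    coeffHom σ n (p * q) = ∑ ij ∈ Finset.HasAntidiagonal.antidiagonal n,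
      coeffHom σ ij.1 p * (σ ^ ij.1 : RingAut A) (coeffHom σ ij.2 q) := by
  induction p using ind with
  | h0 => simp
  | ha f g hf hg => simp [add_mul, hf, hg, Finset.sum_add_distrib]
  | h1 i a =>
    induction q using ind with
    | h0 => simp
    | ha f g hf hg => simp only [mul_add, map_add, hf, hg, Finset.sum_add_distrib]
    | h1 j b =>
      rw [term_mul_term]
      simp only [coeffHom_term]
      by_cases h : i + j = n
      · rw [if_pos h, Finset.sum_eq_single (i, j)]
        · simp
        · rintro ⟨i', j'⟩ - hne
          by_cases h1 : i = i'
          · have h2 : j ≠ j' := fun h2 => hne (by rw [h1, h2])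
            simp [h2]
          · simp [h1]
        · intro hn
          exact absurd (Finset.HasAntidiagonal.mem_antidiagonal.2 h) hn
      · rw [if_neg h, Finset.sum_eq_zero]
        rintro ⟨i', j'⟩ hij
        rw [Finset.HasAntidiagonal.mem_antidiagonal] at hij
        by_cases h1 : i = i'
        · have h2 : j ≠ j' := fun h2 => h (by rw [h1, h2]; exact hij)
          simp [h2]
        · simp [h1]

theorem coeffHom_C_mul (a : A) (p : SkewPoly σ) (n : ℕ) :
    coeffHom σ n (C σ a * p) = a * coeffHom σ n p := by
  rw [coeffHom_mul, Finset.sum_eq_single (0, n)]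
  · simp [coeffHom_C]
  · rintro ⟨i, j⟩ hij hne
    have h : 0 ≠ i := by
      rintro rfl
      exact hne (by simpa using hij)
    simp [coeffHom_C, h]
  · simp

theorem coeffHom_mul_C (a : A) (p : SkewPoly σ) (n : ℕ) :
    coeffHom σ n (p * C σ a) = coeffHom σ n p * (σ ^ n : RingAut A) a := by
  rw [coeffHom_mul, Finset.sum_eq_single (n, 0)]
  · simp [coeffHom_C]
  · rintro ⟨i, j⟩ hij hne
    have h : 0 ≠ j := by
      rintro rfl
      exact hne (by simpa using hij)
    simp [coeffHom_C, h]
  · simp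

/-- The degree of `p` is less than `n`: all coefficients from the `n`-th on vanish. -/
def DegLT (n : ℕ) (p : SkewPoly σ) : Prop := ∀ m, n ≤ m → coeffHom σ m p = 0

theorem DegLT.sub {n : ℕ} {p q : SkewPoly σ} (hp : DegLT n p) (hq : DegLT n q) :
    DegLT n (p - q) := fun m hm => by rw [map_sub, hp m hm, hq m hm, sub_zero]

theorem DegLT.of_succ {n : ℕ} {p : SkewPoly σ} (hp : DegLT (n + 1) p)
    (h : coeffHom σ n p = 0) : DegLT n p := fun m hm => by
  rcases hm.eq_or_lt with rfl | hm
  · exact h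
  · exact hp m hm

theorem DegLT.eq_zero {p : SkewPoly σ} (hp : DegLT 0 p) : p = 0 :=
  ext_coeffHom fun n => by rw [hp n n.zero_le, map_zero]

theorem degLT_term (a : A) (n : ℕ) : DegLT (n + 1) (C σ a * θ σ ^ n) := fun m hm => by
  rw [coeffHom_term, if_neg (by omega)]

theorem exists_degLT (p : SkewPoly σ) : ∃ n, DegLT n p := by
  induction p using ind with
  | h0 => exact ⟨0, fun m _ => map_zero _⟩
  | h1 n a => exact ⟨n + 1, degLT_term a n⟩
  | ha f g hf hg =>
    obtain ⟨n, hn⟩ := hf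
    obtain ⟨m, hm⟩ := hg
    exact ⟨n + m, fun i hi => by rw [map_add, hn i (by omega), hm i (by omega), add_zero]⟩

/-- A nonzero skew polynomial has a degree `n` and a leading coefficient, the `n`-th one. -/
theorem exists_leading {p : SkewPoly σ} (hp : p ≠ 0) :
    ∃ n, DegLT (n + 1) p ∧ coeffHom σ n p ≠ 0 := by
  classical
  have h := exists_degLT p
  obtain ⟨n, hn⟩ : ∃ n, Nat.find h = n + 1 := by
    refine Nat.exists_eq_succ_of_ne_zero fun h0 => hp ?_
    have := Nat.find_spec h
    rw [h0] at this
    exact this.eq_zero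
  have h1 := Nat.find_spec h
  rw [hn] at h1
  exact ⟨n, h1, fun h2 => Nat.find_min h (m := n) (by omega) (h1.of_succ h2)⟩

theorem DegLT.coeffHom_mul_add {n m : ℕ} {p q : SkewPoly σ} (hp : DegLT (n + 1) p)
    (hq : DegLT (m + 1) q) :
    coeffHom σ (n + m) (p * q) = coeffHom σ n p * (σ ^ n : RingAut A) (coeffHom σ m q) := by
  rw [coeffHom_mul, Finset.sum_eq_single (n, m)]
  · rintro ⟨i, j⟩ hij hne
    rw [Finset.HasAntidiagonal.mem_antidiagonal] at hij
    dsimp only at hij ⊢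
    rcases lt_trichotomy i n with h | h | h
    · rw [hq j (by omega)]; simp
    · exact absurd (by rw [h, show j = m by omega]) hne
    · rw [hp i h, zero_mul]
  · simp

theorem DegLT.mul {n m : ℕ} {p q : SkewPoly σ} (hp : DegLT (n + 1) p) (hq : DegLT (m + 1) q) :
    DegLT (n + m + 1) (p * q) := fun l hl => by
  rw [coeffHom_mul]
  refine Finset.sum_eq_zero ?_
  rintro ⟨i, j⟩ hij
  rw [Finset.HasAntidiagonal.mem_antidiagonal] at hij
  dsimp only at hij ⊢
  by_cases h : n + 1 ≤ i
  · rw [hp i h, zero_mul]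
  · rw [hq j (by omega)]; simp

theorem C_injective : Function.Injective (C σ) := fun a b h => by
  simpa [coeffHom_C] using congrArg (coeffHom σ 0) h

instance [NoZeroDivisors A] : NoZeroDivisors (SkewPoly σ) where
  eq_zero_or_eq_zero_of_mul_eq_zero {p q} h := by
    by_contra! hpq
    obtain ⟨n, hn, hn'⟩ := exists_leading hpq.1
    obtain ⟨m, hm, hm'⟩ := exists_leading hpq.2
    have := hn.coeffHom_mul_add hm
    rw [h, map_zero] at this
    refine mul_ne_zero hn' ?_ this.symm
    exact (map_ne_zero_iff (σ ^ n : RingAut A) (RingEquiv.injective _)).2 hm'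

instance [Nontrivial A] : Nontrivial (SkewPoly σ) := C_injective.nontrivial

/-- Every right ideal of a skew polynomial ring over a division ring is principal: an element of
least degree divides all others on the left, because leading coefficients can be cancelled using
the inverse of the automorphism. -/
theorem exists_eq_rightIdeal {K : Type*} [DivisionRing K] {τ : K ≃+* K}
    (J : Submodule (SkewPoly τ)ᵐᵒᵖ (SkewPoly τ)) : ∃ b, J = rightIdeal b := by
  classical
  by_cases hJ : J = ⊥
  · exact ⟨0, by simpa [rightIdeal] using hJ⟩
  obtain ⟨b₀, hb₀, hb₀'⟩ := Submodule.exists_mem_ne_zero_of_ne_bot hJ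
  obtain ⟨n₀, hn₀⟩ := exists_degLT b₀
  have hex : ∃ n, ∃ b ∈ J, b ≠ 0 ∧ DegLT n b := ⟨n₀, b₀, hb₀, hb₀', hn₀⟩
  obtain ⟨b, hbJ, hb0, hdeg⟩ := Nat.find_spec hex
  have hmin : ∀ m < Nat.find hex, ∀ a ∈ J, DegLT m a → a = 0 := fun m hm a ha had => by
    by_contra ha0
    exact Nat.find_min hex hm ⟨a, ha, ha0, had⟩
  obtain ⟨n, hn⟩ : ∃ n, Nat.find hex = n + 1 := by
    refine Nat.exists_eq_succ_of_ne_zero fun h0 => hb0 ?_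
    rw [h0] at hdeg
    exact hdeg.eq_zero
  rw [hn] at hdeg hmin
  have hlead : coeffHom τ n b ≠ 0 := fun h => hb0 (hmin n (by omega) b hbJ (hdeg.of_succ h))
  refine ⟨b, le_antisymm ?_ ((Submodule.span_singleton_le_iff_mem _ _).2 hbJ)⟩
  have key : ∀ m, ∀ a ∈ J, DegLT m a → a ∈ rightIdeal b := by
    intro m
    induction m with
    | zero =>
      intro a _ had
      rw [had.eq_zero]
      exact zero_mem _
    | succ m ih =>
      intro a haJ had
      rcases Nat.lt_or_ge m n with hmn | hmn
      · rw [hmin (m + 1) (by omega) a haJ had]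
        exact zero_mem _
      obtain ⟨c, hc⟩ := (τ ^ n : RingAut K).surjective ((coeffHom τ n b)⁻¹ * coeffHom τ m a)
      set t : SkewPoly τ := C τ c * θ τ ^ (m - n) with ht
      have htd : DegLT (m - n + 1) t := degLT_term c (m - n)
      have hbt : b * t ∈ rightIdeal b :=
        (rightIdeal b).smul_mem (MulOpposite.op t) (Submodule.mem_span_singleton_self b)
      have hnm : n + (m - n) = m := by omega
      have h1 := hdeg.coeffHom_mul_add htd
      have h2 := hdeg.mul htd
      rw [hnm] at h1 h2
      have h3 : coeffHom τ (m - n) t = c := by rw [ht, coeffHom_term, if_pos rfl]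
      have h4 : coeffHom τ m (b * t) = coeffHom τ m a := by
        rw [h1, h3]
        exact (congrArg _ hc).trans (mul_inv_cancel_left₀ hlead _)
      have h5 : a - b * t ∈ rightIdeal b := by
        refine ih _ (J.sub_mem haJ (J.smul_mem (MulOpposite.op t) hbJ)) ?_
        exact (had.sub h2).of_succ (by rw [map_sub, h4, sub_self])
      simpa using add_mem h5 hbt
  intro a ha
  obtain ⟨m, hm⟩ := exists_degLT a
  exact key m a ha hm

/-- The ring homomorphism `A[θ; σ] → D` given by a ring homomorphism `f` on the coefficients and
the image `t` of `θ`, which has to satisfy `t f(a) = f(σ a) t`. -/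
def lift {D : Type*} [Ring D] (f : A →+* D) (t : D) (h : ∀ a, t * f a = f (σ a) * t) :
    SkewPoly σ →+* D :=
  letI := skewAction σ
  (SkewMonoidAlgebra.liftNCRingHom f (powersHom D t) (by
    intro a y
    have key : ∀ n : ℕ, f ((σ ^ n : RingAut A) a) * t ^ n = t ^ n * f a := by
      intro n
      induction n with
      | zero => simp
      | succ n ih =>
        rw [pow_succ', pow_succ' t, mul_assoc, ← ih, ← mul_assoc t, h, mul_assoc]
        rfl
    exact key y.toAdd) : SkewPolynomial A →+* D)

theorem lift_C {D : Type*} [Ring D] (f : A →+* D) (t : D) (h : ∀ a, t * f a = f (σ a) * t)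
    (a : A) : lift f t h (C σ a) = f a := by
  let _ := skewAction σ
  exact (SkewMonoidAlgebra.liftNC_single _ _ _ _).trans (by simp)

theorem lift_θ {D : Type*} [Ring D] (f : A →+* D) (t : D) (h : ∀ a, t * f a = f (σ a) * t) :
    lift f t h (θ σ) = t := by
  let _ := skewAction σ
  exact (SkewMonoidAlgebra.liftNC_single _ _ _ _).trans (by simp)

end SkewPoly

end

noncomputable section

/-! ### Right ideals and right modules -/

section RightIdeals

open MulOpposite

variable {D : Type*} [Ring D]

theorem mem_rightIdeal {z y : D} : y ∈ rightIdeal z ↔ ∃ s, z * s = y := by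
  rw [Submodule.mem_span_singleton]
  exact ⟨fun ⟨a, ha⟩ => ⟨a.unop, ha⟩, fun ⟨s, hs⟩ => ⟨op s, hs⟩⟩

theorem self_mem_rightIdeal (z : D) : z ∈ rightIdeal z := Submodule.mem_span_singleton_self z

theorem rightIdeal_le_iff {z : D} {J : Submodule Dᵐᵒᵖ D} : rightIdeal z ≤ J ↔ z ∈ J :=
  Submodule.span_singleton_le_iff_mem _ _

theorem mul_mem_right {J : Submodule Dᵐᵒᵖ D} {a : D} (ha : a ∈ J) (b : D) : a * b ∈ J :=
  J.smul_mem (op b) ha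

theorem eq_top_of_one_mem {J : Submodule Dᵐᵒᵖ D} (h : 1 ∈ J) : J = ⊤ :=
  eq_top_iff.2 fun s _ => by simpa using mul_mem_right h s

theorem isCoatom_iff_exists_one_sub_mem {J : Submodule Dᵐᵒᵖ D} :
    IsCoatom J ↔ 1 ∉ J ∧ ∀ a ∉ J, ∃ b, 1 - a * b ∈ J := by
  constructor
  · refine fun h => ⟨fun h1 => h.1 (eq_top_of_one_mem h1), fun a ha => ?_⟩
    have hsup : J ⊔ rightIdeal a = ⊤ := by
      refine h.2 _ (lt_of_le_of_ne le_sup_left fun he => ha ?_)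
      rw [he]
      exact Submodule.mem_sup_right (self_mem_rightIdeal a)
    obtain ⟨j, hj, c, hc, hjc⟩ := Submodule.mem_sup.1 (hsup ▸ Submodule.mem_top : (1 : D) ∈ _)
    obtain ⟨b, rfl⟩ := mem_rightIdeal.1 hc
    exact ⟨b, by rwa [← hjc, add_sub_cancel_right]⟩
  · rintro ⟨h1, h2⟩
    refine ⟨fun h => h1 (h ▸ Submodule.mem_top), fun K hK => ?_⟩
    obtain ⟨a, haK, haJ⟩ := SetLike.exists_of_lt hK
    obtain ⟨b, hb⟩ := h2 a haJ
    exact eq_top_of_one_mem (by simpa using K.add_mem (hK.le hb) (mul_mem_right haK b))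

theorem mul_eq_one_comm_of_noZeroDivisors [NoZeroDivisors D] {a b : D} (h : a * b = 1) :
    b * a = 1 := by
  nontriviality D
  have ha : a ≠ 0 := by
    rintro rfl
    simp at h
  refine sub_eq_zero.1 ((mul_eq_zero.1 (?_ : a * (b * a - 1) = 0)).resolve_left ha)
  rw [mul_sub, ← mul_assoc, h, one_mul, mul_one, sub_self]

theorem one_mem_rightIdeal_iff [NoZeroDivisors D] {z : D} : 1 ∈ rightIdeal z ↔ IsUnit z := by
  rw [mem_rightIdeal]
  constructor
  · rintro ⟨s, hs⟩
    exact ⟨⟨z, s, hs, mul_eq_one_comm_of_noZeroDivisors hs⟩, rfl⟩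
  · rintro ⟨u, rfl⟩
    exact ⟨_, u.mul_inv⟩

theorem irreducible_of_isCoatom [NoZeroDivisors D] {z : D} (hz : z ≠ 0)
    (h : IsCoatom (rightIdeal z)) : Irreducible z := by
  refine ⟨fun hu => h.1 (eq_top_of_one_mem (one_mem_rightIdeal_iff.2 hu)), fun a b hab => ?_⟩
  by_cases ha : a ∈ rightIdeal z
  · obtain ⟨c, rfl⟩ := mem_rightIdeal.1 ha
    have hcb : c * b = 1 := by
      refine sub_eq_zero.1 ((mul_eq_zero.1 (?_ : z * (c * b - 1) = 0)).resolve_left hz)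
      rw [mul_sub, ← mul_assoc, ← hab, mul_one, sub_self]
    exact .inr ⟨⟨b, c, mul_eq_one_comm_of_noZeroDivisors hcb, hcb⟩, rfl⟩
  · left
    rw [← one_mem_rightIdeal_iff]
    obtain ⟨b', hb'⟩ := (isCoatom_iff_exists_one_sub_mem.1 h).2 a ha
    have hle : rightIdeal z ≤ rightIdeal a := rightIdeal_le_iff.2 (mem_rightIdeal.2 ⟨b, hab.symm⟩)
    simpa using add_mem (hle hb') (mem_rightIdeal.2 ⟨b', rfl⟩)

theorem isCoatom_of_irreducible [NoZeroDivisors D]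
    (hD : ∀ J : Submodule Dᵐᵒᵖ D, ∃ b, J = rightIdeal b) {z : D} (h : Irreducible z) :
    IsCoatom (rightIdeal z) := by
  refine ⟨fun ht => h.not_isUnit (one_mem_rightIdeal_iff.1 (ht ▸ Submodule.mem_top)),
    fun K hK => ?_⟩
  obtain ⟨w, rfl⟩ := hD K
  obtain ⟨c, hc⟩ := mem_rightIdeal.1 (hK.le (self_mem_rightIdeal z))
  rcases h.isUnit_or_isUnit hc.symm with hw | hu
  · exact eq_top_of_one_mem (one_mem_rightIdeal_iff.2 hw)
  · obtain ⟨u, rfl⟩ := hu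
    refine absurd (rightIdeal_le_iff.2 (mem_rightIdeal.2 ⟨(↑u⁻¹ : D), ?_⟩)) hK.not_ge
    rw [← hc, mul_assoc, u.mul_inv, mul_one]

/-- An element `u` implementing the similarity of `z` and `y` is a representative of the image of
`1` under an isomorphism `D / z D ≃ D / y D`. -/
theorem nonempty_quotient_equiv_iff_isSimilar [NoZeroDivisors D] {z y : D} (hz : ¬ IsUnit z) :
    Nonempty ((D ⧸ rightIdeal z) ≃ₗ[Dᵐᵒᵖ] (D ⧸ rightIdeal y)) ↔ IsSimilar z y := by
  constructor
  · rintro ⟨e⟩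
    obtain ⟨u, hu⟩ := Submodule.Quotient.mk_surjective _ (e (Submodule.Quotient.mk 1))
    have he : ∀ t : D, e (Submodule.Quotient.mk t) = Submodule.Quotient.mk (u * t) := fun t => by
      have : (Submodule.Quotient.mk t : D ⧸ rightIdeal z) = op t • Submodule.Quotient.mk 1 := by
        rw [← Submodule.Quotient.mk_smul]
        simp
      rw [this, map_smul, ← hu]
      rfl
    have hker : ∀ t : D, u * t ∈ rightIdeal y ↔ t ∈ rightIdeal z := fun t => by
      rw [← Submodule.Quotient.mk_eq_zero, ← he, map_eq_zero_iff _ e.injective,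
        Submodule.Quotient.mk_eq_zero]
    refine ⟨u, ?_, ?_, ?_⟩
    · rintro rfl
      exact hz (one_mem_rightIdeal_iff.1 ((hker 1).1 (by simp)))
    · refine eq_top_of_one_mem ?_
      obtain ⟨q, hq⟩ := e.surjective (Submodule.Quotient.mk 1)
      obtain ⟨t, rfl⟩ := Submodule.Quotient.mk_surjective _ q
      rw [he, Submodule.Quotient.eq] at hq
      have h1 : u * t ∈ rightIdeal u ⊔ rightIdeal y :=
        Submodule.mem_sup_left (mem_rightIdeal.2 ⟨t, rfl⟩)
      simpa using sub_mem h1 (Submodule.mem_sup_right hq)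
    · refine le_antisymm (rightIdeal_le_iff.2 ⟨mem_rightIdeal.2 ⟨z, rfl⟩, ?_⟩) ?_
      · exact (hker z).2 (self_mem_rightIdeal z)
      · rintro a ⟨ha, hay⟩
        obtain ⟨t, rfl⟩ := mem_rightIdeal.1 ha
        obtain ⟨s, rfl⟩ := mem_rightIdeal.1 ((hker t).1 hay)
        exact mem_rightIdeal.2 ⟨s, mul_assoc _ _ _⟩
  · rintro ⟨u, hu0, hsup, hinf⟩
    let f : D →ₗ[Dᵐᵒᵖ] D ⧸ rightIdeal y :=
      { toFun := fun t => Submodule.Quotient.mk (u * t)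
        map_add' := fun a b => by rw [mul_add]; rfl
        map_smul' := fun a b => by
          rw [RingHom.id_apply, ← Submodule.Quotient.mk_smul]
          simp [mul_assoc] }
    have hker : LinearMap.ker f = rightIdeal z := by
      ext t
      rw [LinearMap.mem_ker]
      change Submodule.Quotient.mk (u * t) = 0 ↔ _
      rw [Submodule.Quotient.mk_eq_zero]
      constructor
      · intro h
        have h1 : u * t ∈ rightIdeal (u * z) := by
          rw [hinf]
          exact ⟨mem_rightIdeal.2 ⟨t, rfl⟩, h⟩
        obtain ⟨s, hs⟩ := mem_rightIdeal.1 h1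
        refine mem_rightIdeal.2 ⟨s, sub_eq_zero.1 ?_⟩
        refine (mul_eq_zero.1 (?_ : u * (z * s - t) = 0)).resolve_left hu0
        rw [mul_sub, ← mul_assoc, hs, sub_self]
      · intro h
        obtain ⟨s, rfl⟩ := mem_rightIdeal.1 h
        have h1 : u * z ∈ rightIdeal u ⊓ rightIdeal y := hinf ▸ self_mem_rightIdeal _
        rw [← mul_assoc]
        exact mul_mem_right h1.2 s
    have hsurj : Function.Surjective f := by
      intro q
      obtain ⟨a, rfl⟩ := Submodule.Quotient.mk_surjective _ q
      obtain ⟨c, hc, d, hd, hcd⟩ := Submodule.mem_sup.1 (hsup ▸ Submodule.mem_top : a ∈ _)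
      obtain ⟨t, rfl⟩ := mem_rightIdeal.1 hc
      refine ⟨t, (Submodule.Quotient.eq _).2 ?_⟩
      rw [← hcd, sub_add_cancel_left]
      exact neg_mem hd
    exact ⟨(Submodule.quotEquivOfEq _ _ hker.symm).trans (f.quotKerEquivOfSurjective hsurj)⟩

variable {V : Type*} [AddCommGroup V] [Module Dᵐᵒᵖ V]

/-- The map `s ↦ v s` from `D` to a right `D`-module. -/
def orbitMap (v : V) : D →ₗ[Dᵐᵒᵖ] V where
  toFun s := op s • v
  map_add' a b := by rw [op_add, add_smul]
  map_smul' a b := by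
    rw [RingHom.id_apply, smul_smul]
    rfl

theorem orbitMap_apply (v : V) (s : D) : orbitMap v s = op s • v := rfl

theorem orbitMap_surjective [IsSimpleModule Dᵐᵒᵖ V] {v : V} (hv : v ≠ 0) :
    Function.Surjective (orbitMap (D := D) v) :=
  (LinearMap.surjective_or_eq_zero _).resolve_right fun h => hv (by
    simpa [orbitMap_apply] using LinearMap.congr_fun h (1 : D))

theorem exists_ne_zero_of_isSimpleModule (D : Type*) [Ring D] (V : Type*) [AddCommGroup V]
    [Module Dᵐᵒᵖ V] [IsSimpleModule Dᵐᵒᵖ V] : ∃ v : V, v ≠ 0 := by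
  have := IsSimpleModule.nontrivial Dᵐᵒᵖ V
  exact exists_ne 0

theorem quotient_isSimpleModule_iff {J : Submodule Dᵐᵒᵖ D} :
    IsSimpleModule Dᵐᵒᵖ (D ⧸ J) ↔ IsCoatom J := isSimpleModule_iff_isCoatom

theorem faithfulSMul_op_iff :
    FaithfulSMul Dᵐᵒᵖ V ↔ ∀ p : D, (∀ v : V, op p • v = 0) → p = 0 := by
  constructor
  · intro h p hp
    exact op_injective (h.eq_of_smul_eq_smul fun v : V => by rw [hp v, op_zero, zero_smul])
  · refine fun h => ⟨fun {a b} hab => ?_⟩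
    refine unop_injective (sub_eq_zero.1 (h (a.unop - b.unop) fun v => ?_))
    rw [op_sub, op_unop, op_unop, sub_smul, hab v, sub_self]

theorem faithfulSMul_of_equiv {W : Type*} [AddCommGroup W] [Module Dᵐᵒᵖ W] (e : V ≃ₗ[Dᵐᵒᵖ] W)
    (h : FaithfulSMul Dᵐᵒᵖ V) : FaithfulSMul Dᵐᵒᵖ W := by
  rw [faithfulSMul_op_iff] at h ⊢
  refine fun p hp => h p fun v => e.injective ?_
  rw [map_smul, hp, map_zero]

/-- `x` is normal in `D`: `x D = D x`. -/
structure IsNormalElement (x : D) : Prop where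
  exists_mul_eq : ∀ s, ∃ s', x * s = s' * x
  exists_eq_mul : ∀ s, ∃ s', s * x = x * s'

theorem IsNormalElement.pow {x : D} (hx : IsNormalElement x) (n : ℕ) :
    IsNormalElement (x ^ n) := by
  induction n with
  | zero => exact ⟨fun s => ⟨s, by simp⟩, fun s => ⟨s, by simp⟩⟩
  | succ n ih =>
    constructor
    · intro s
      obtain ⟨a, ha⟩ := hx.exists_mul_eq s
      obtain ⟨b, hb⟩ := ih.exists_mul_eq a
      exact ⟨b, by rw [pow_succ, mul_assoc, ha, ← mul_assoc, hb, mul_assoc]⟩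
    · intro s
      obtain ⟨a, ha⟩ := ih.exists_eq_mul s
      obtain ⟨b, hb⟩ := hx.exists_eq_mul a
      exact ⟨b, by rw [pow_succ, ← mul_assoc, ha, mul_assoc, hb, mul_assoc]⟩

/-- A normal element acts on a simple module as zero or bijectively, since the kernel and the
image of its action are submodules. -/
theorem IsNormalElement.smul_eq_zero_or_bijective {x : D} (hx : IsNormalElement x)
    [IsSimpleModule Dᵐᵒᵖ V] :
    (∀ v : V, op x • v = 0) ∨ Function.Bijective (fun v : V => op x • v) := by
  let K : Submodule Dᵐᵒᵖ V :=
    { carrier := {v | op x • v = 0}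
      add_mem' := fun {a b} ha hb => by
        rw [Set.mem_ofPred_eq] at *
        rw [smul_add, ha, hb, add_zero]
      zero_mem' := smul_zero _
      smul_mem' := fun a v hv => by
        obtain ⟨s', hs'⟩ := hx.exists_eq_mul a.unop
        rw [Set.mem_ofPred_eq] at *
        rw [smul_smul, ← op_unop a, ← op_mul, hs', op_mul, mul_smul, hv, smul_zero] }
  let I : Submodule Dᵐᵒᵖ V :=
    { carrier := {v | ∃ w, op x • w = v}
      add_mem' := by
        rintro _ _ ⟨a, rfl⟩ ⟨b, rfl⟩
        exact ⟨a + b, smul_add _ _ _⟩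
      zero_mem' := ⟨0, smul_zero _⟩
      smul_mem' := by
        rintro a _ ⟨w, rfl⟩
        obtain ⟨s', hs'⟩ := hx.exists_mul_eq a.unop
        exact ⟨op s' • w, by rw [smul_smul, smul_smul, ← op_mul, ← hs', op_mul, op_unop]⟩ }
  rcases eq_bot_or_eq_top K with hK | hK
  · rcases eq_bot_or_eq_top I with hI | hI
    · left
      intro v
      have : op x • v ∈ I := ⟨v, rfl⟩
      rwa [hI] at this
    · right
      refine ⟨fun v w hvw => sub_eq_zero.1 ?_, fun v => ?_⟩
      · have : v - w ∈ K := by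
          change op x • (v - w) = 0
          rw [smul_sub]
          exact sub_eq_zero.2 hvw
        rwa [hK] at this
      · exact (hI ▸ Submodule.mem_top : v ∈ I)
  · left
    intro v
    exact (hK ▸ Submodule.mem_top : v ∈ K)

end RightIdeals

end

noncomputable section

section Setting

open MulOpposite SkewPoly

variable {k : Type*} [Field k] {R : Type*} [CommRing R] [IsDomain R] [Algebra k R]
  [IsDiscreteValuationRing R]

/-! ### The coefficient ring -/

theorem irreducible_uniformizer {x : R} (hx : IsLocalRing.maximalIdeal R = Ideal.span {x}) :
    Irreducible x :=
  (IsDiscreteValuationRing.irreducible_iff_uniformizer x).2 hx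

theorem exists_unit_map_uniformizer {x : R} (hx : IsLocalRing.maximalIdeal R = Ideal.span {x})
    (τ : R ≃+* R) : ∃ v : Rˣ, τ x = v * x := by
  have hirr := irreducible_uniformizer hx
  obtain ⟨v, hv⟩ := IsDiscreteValuationRing.associated_of_irreducible R hirr
    ((MulEquiv.irreducible_iff τ).2 hirr)
  exact ⟨v, by rw [← hv, mul_comm]⟩

/-- The residue map of `R`, with the residue field identified with `k`. -/
def resHom (hres : Function.Bijective (algebraMap k (IsLocalRing.ResidueField R))) : R →+* k :=
  ((RingEquiv.ofBijective _ hres).symm : IsLocalRing.ResidueField R →+* k).comp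
    (IsLocalRing.residue R)

variable (hres : Function.Bijective (algebraMap k (IsLocalRing.ResidueField R)))

theorem resHom_algebraMap (c : k) : resHom hres (algebraMap k R c) = c :=
  (RingEquiv.ofBijective _ hres).symm_apply_apply c

theorem resHom_eq_zero_iff {x : R} (hx : IsLocalRing.maximalIdeal R = Ideal.span {x}) (r : R) :
    resHom hres r = 0 ↔ x ∣ r := by
  rw [← Ideal.mem_span_singleton, ← hx, ← IsLocalRing.residue_eq_zero_iff]
  exact map_eq_zero_iff (RingEquiv.ofBijective _ hres).symm (RingEquiv.injective _)

/-- Since the residue field is `k`, every `k`-algebra automorphism of `R` induces the identity on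
it. -/
theorem resHom_algEquiv (α : R ≃ₐ[k] R) (r : R) : resHom hres (α r) = resHom hres r := by
  obtain ⟨x, hx⟩ := (IsPrincipalIdealRing.principal (IsLocalRing.maximalIdeal R)).1
  rw [Ideal.submodule_span_eq] at hx
  have h1 : x ∣ r - algebraMap k R (resHom hres r) := by
    rw [← resHom_eq_zero_iff hres hx, map_sub, resHom_algebraMap, sub_self]
  obtain ⟨b, hb⟩ := h1
  obtain ⟨v, hv⟩ := exists_unit_map_uniformizer hx (α : R ≃+* R)
  have h2 : α r - algebraMap k R (resHom hres r) = x * (v * α b) := by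
    rw [← α.commutes (resHom hres r), ← map_sub, hb, map_mul, show α x = v * x from hv]
    ring
  have h3 := (resHom_eq_zero_iff hres hx _).2 (Dvd.intro _ h2.symm)
  rwa [map_sub, resHom_algebraMap, sub_eq_zero] at h3

/-! ### Reduction modulo the uniformizer -/

variable (α : R ≃ₐ[k] R)

/-- Reduction modulo the uniformizer, as a homomorphism from `S` to the commutative polynomial
ring `k[X]`; it sends `θ` to `X`. -/
def red : SRing α →+* k[X] :=
  lift ((Polynomial.C : k →+* k[X]).comp (resHom hres)) X fun a => by
    rw [X_mul]
    exact congrArg (fun c => Polynomial.C c * X) (resHom_algEquiv hres α a).symm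

theorem red_C (r : R) : red hres α (inS α r) = Polynomial.C (resHom hres r) :=
  lift_C _ _ _ _

theorem red_θ : red hres α (θ (α : R ≃+* R)) = X :=
  lift_θ _ _ _

theorem coeff_red (p : SRing α) (n : ℕ) :
    (red hres α p).coeff n = resHom hres (coeffHom _ n p) := by
  induction p using ind with
  | h0 => simp
  | h1 m a =>
    rw [coeffHom_term, map_mul, map_pow, red_C, red_θ, coeff_C_mul_X_pow, apply_ite (resHom hres),
      map_zero]
    simp only [eq_comm]
  | ha f g hf hg => rw [map_add, coeff_add, hf, hg, map_add, map_add]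

theorem red_polyToS (f : k[X]) : red hres α (polyToS α f) = f := by
  rw [polyToS, eval₂_eq_sum, Polynomial.sum, map_sum]
  conv_rhs => rw [f.as_sum_support_C_mul_X_pow]
  refine Finset.sum_congr rfl fun n _ => ?_
  rw [map_mul, map_pow, red_θ]
  congr 2
  exact (red_C hres α _).trans (by rw [resHom_algebraMap])

variable {x : R}

omit [IsDomain R] [IsDiscreteValuationRing R] in
theorem mem_rightIdeal_of_forall_dvd {p : SRing α} (h : ∀ n, x ∣ coeffHom _ n p) :
    p ∈ rightIdeal (inS α x) := by
  have key : ∀ N, ∀ p : SRing α, DegLT N p → (∀ n, x ∣ coeffHom _ n p) →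
      p ∈ rightIdeal (inS α x) := by
    intro N
    induction N with
    | zero =>
      intro p hp _
      rw [hp.eq_zero]
      exact zero_mem _
    | succ N ih =>
      intro p hp hdvd
      obtain ⟨c, hc⟩ := hdvd N
      have h1 : p - inS α x * (inS α c * θ _ ^ N) ∈ rightIdeal (inS α x) := by
        have he : inS α x * (inS α c * θ _ ^ N) = inS α (x * c) * θ (α : R ≃+* R) ^ N := by
          rw [← mul_assoc, ← map_mul]
        rw [he]
        refine ih _ ((hp.sub (degLT_term _ N)).of_succ ?_) fun n => ?_
        · rw [map_sub, coeffHom_term, if_pos rfl, hc, sub_self]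
        · rw [map_sub, coeffHom_term]
          refine dvd_sub (hdvd n) ?_
          split_ifs
          · exact dvd_mul_right x c
          · exact dvd_zero x
      have h2 := add_mem h1 (mem_rightIdeal.2 ⟨inS α c * θ _ ^ N, rfl⟩)
      rwa [sub_add_cancel] at h2
  obtain ⟨N, hN⟩ := exists_degLT p
  exact key N p hN h

section Uniformizer

variable (hx : IsLocalRing.maximalIdeal R = Ideal.span {x})
include hx

theorem red_eq_zero_iff {p : SRing α} : red hres α p = 0 ↔ p ∈ rightIdeal (inS α x) := by
  constructor
  · refine fun h => mem_rightIdeal_of_forall_dvd α fun n => ?_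
    rw [← resHom_eq_zero_iff hres hx, ← coeff_red, h, Polynomial.coeff_zero]
  · intro h
    obtain ⟨s, rfl⟩ := mem_rightIdeal.1 h
    rw [map_mul, red_C, (resHom_eq_zero_iff hres hx x).2 dvd_rfl, map_zero, zero_mul]

omit [IsDomain R] [IsDiscreteValuationRing R] hx in
theorem isNormalElement_θ : IsNormalElement (θ (α : R ≃+* R)) := by
  constructor
  · intro s
    induction s using ind with
    | h0 => exact ⟨0, by simp⟩
    | h1 n a =>
      exact ⟨C _ ((α : R ≃+* R) a) * θ _ ^ n, by
        rw [← mul_assoc, θ_mul_C, mul_assoc, mul_assoc, ← pow_succ, ← pow_succ']⟩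
    | ha f g hf hg =>
      obtain ⟨f', hf⟩ := hf
      obtain ⟨g', hg⟩ := hg
      exact ⟨f' + g', by rw [mul_add, add_mul, hf, hg]⟩
  · intro s
    induction s using ind with
    | h0 => exact ⟨0, by simp⟩
    | h1 n a =>
      exact ⟨C _ ((α : R ≃+* R).symm a) * θ _ ^ n, by
        rw [← mul_assoc, θ_mul_C, RingEquiv.apply_symm_apply, mul_assoc, mul_assoc, ← pow_succ,
          ← pow_succ']⟩
    | ha f g hf hg =>
      obtain ⟨f', hf⟩ := hf
      obtain ⟨g', hg⟩ := hg
      exact ⟨f' + g', by rw [mul_add, add_mul, hf, hg]⟩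

theorem isNormalElement_uniformizer : IsNormalElement (inS α x) := by
  constructor
  · intro s
    induction s using ind with
    | h0 => exact ⟨0, by simp⟩
    | h1 n a =>
      obtain ⟨v, hv⟩ := exists_unit_map_uniformizer hx ((α : R ≃+* R) ^ n : RingAut R)
      refine ⟨C _ a * C _ (↑v⁻¹ : R) * θ _ ^ n, ?_⟩
      rw [mul_assoc, θ_pow_mul_C]
      simp only [← mul_assoc, ← map_mul]
      congr 2
      rw [hv]
      linear_combination (-(a * x)) * v.inv_mul
    | ha f g hf hg =>
      obtain ⟨f', hf⟩ := hf
      obtain ⟨g', hg⟩ := hg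
      exact ⟨f' + g', by rw [mul_add, add_mul, hf, hg]⟩
  · intro s
    induction s using ind with
    | h0 => exact ⟨0, by simp⟩
    | h1 n a =>
      obtain ⟨v, hv⟩ := exists_unit_map_uniformizer hx ((α : R ≃+* R) ^ n : RingAut R)
      refine ⟨C _ a * C _ (v : R) * θ _ ^ n, ?_⟩
      rw [mul_assoc, θ_pow_mul_C]
      simp only [← mul_assoc, ← map_mul]
      congr 2
      rw [hv]
      ring
    | ha f g hf hg =>
      obtain ⟨f', hf⟩ := hf
      obtain ⟨g', hg⟩ := hg
      exact ⟨f' + g', by rw [mul_add, add_mul, hf, hg]⟩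

theorem exists_eq_mul_uniformizer {p : SRing α} (h : p ∈ rightIdeal (inS α x)) :
    ∃ s, p = s * inS α x := by
  obtain ⟨s, rfl⟩ := mem_rightIdeal.1 h
  exact (isNormalElement_uniformizer α hx).exists_mul_eq s

theorem inS_uniformizer_ne_zero : inS α x ≠ 0 := by
  have := (irreducible_uniformizer hx).ne_zero
  simpa using SkewPoly.C_injective.ne this

/-- Every nonzero element of `S` is the product of an element outside `x S` and a power of `x`. -/
theorem exists_eq_mul_pow {p : SRing α} (hp : p ≠ 0) :
    ∃ (n : ℕ) (z : SRing α), p = z * inS α x ^ n ∧ z ∉ rightIdeal (inS α x) := by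
  have key : ∀ N i, ∀ p : SRing α, ¬ x ^ N ∣ coeffHom _ i p →
      ∃ (n : ℕ) (z : SRing α), p = z * inS α x ^ n ∧ z ∉ rightIdeal (inS α x) := by
    intro N i
    induction N with
    | zero => exact fun p h => absurd (by simp) h
    | succ N ih =>
      intro p h
      by_cases hpx : p ∈ rightIdeal (inS α x)
      · obtain ⟨s, rfl⟩ := exists_eq_mul_uniformizer α hx hpx
        obtain ⟨v, hv⟩ := exists_unit_map_uniformizer hx ((α : R ≃+* R) ^ i : RingAut R)
        obtain ⟨n, z, hz, hzx⟩ := ih s fun hs => h (by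
          rw [coeffHom_mul_C, pow_succ]
          exact mul_dvd_mul hs (hv ▸ dvd_mul_left x (v : R)))
        exact ⟨n + 1, z, by rw [hz, mul_assoc, pow_succ], hzx⟩
      · exact ⟨0, p, by simp, hpx⟩
  obtain ⟨i, -, hi⟩ := exists_leading hp
  obtain ⟨N, hN⟩ := FiniteMultiplicity.of_prime_left (irreducible_uniformizer hx).prime hi
  exact key _ i p hN

theorem toT_uniformizer_mul_right_cancel {n : ℕ} {a b : TRing α}
    (h : a * toT α (inS α x) ^ n = b * toT α (inS α x) ^ n) : a = b :=
  ((isUnit_toT_inS α x (irreducible_uniformizer hx).ne_zero).pow n).mul_right_cancel h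

include hres

theorem mem_of_mul_mem_uniformizer {z s : SRing α} (hz : z ∉ rightIdeal (inS α x))
    (h : z * s ∈ rightIdeal (inS α x)) : s ∈ rightIdeal (inS α x) := by
  rw [← red_eq_zero_iff hres α hx] at *
  rw [map_mul] at h
  exact (mul_eq_zero.1 h).resolve_left hz

/-- `z T ∩ S = z S` for `z` outside the completely prime ideal `x S`. -/
theorem toT_mem_rightIdeal_iff {z : SRing α} (hz : z ∉ rightIdeal (inS α x)) {s : SRing α} :
    toT α s ∈ rightIdeal (toT α z) ↔ s ∈ rightIdeal z := by
  constructor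
  · intro h
    obtain ⟨t, ht⟩ := mem_rightIdeal.1 h
    obtain ⟨n, r, hr⟩ := exists_mul_pow_eq_toT α x hx t
    have key : ∀ n r, t * toT α (inS α x) ^ n = toT α r → ∃ r', t = toT α r' := by
      intro n
      induction n with
      | zero => exact fun r hr => ⟨r, by simpa using hr⟩
      | succ n ih =>
        intro r hr
        have h1 : z * r = s * inS α x ^ (n + 1) := toT_injective α (by
          rw [map_mul, map_mul, map_pow, ← hr, ← ht, mul_assoc])
        have h2 : r ∈ rightIdeal (inS α x) := by
          refine mem_of_mul_mem_uniformizer hres α hx hz ?_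
          obtain ⟨s', hs'⟩ := (isNormalElement_uniformizer α hx).exists_eq_mul (s * inS α x ^ n)
          rw [h1, pow_succ, ← mul_assoc, hs']
          exact mem_rightIdeal.2 ⟨_, rfl⟩
        obtain ⟨r', rfl⟩ := exists_eq_mul_uniformizer α hx h2
        refine ih r' (toT_uniformizer_mul_right_cancel α hx (n := 1) ?_)
        rw [mul_assoc, ← pow_add, hr, map_mul, pow_one]
    obtain ⟨r', rfl⟩ := key n r hr
    exact mem_rightIdeal.2 ⟨r', toT_injective α (by rw [map_mul, ht])⟩
  · intro h
    obtain ⟨r, rfl⟩ := mem_rightIdeal.1 h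
    exact mem_rightIdeal.2 ⟨toT α r, (map_mul _ _ _).symm⟩

end Uniformizer

/-! ### Comparison of `S / z S` with `T / z T` -/

omit [IsDomain R] [IsDiscreteValuationRing R] in
theorem op_smul_eq_op_toT_smul (I : Submodule (TRing α)ᵐᵒᵖ (TRing α)) (s : SRing α)
    (q : TRing α ⧸ I) : op s • q = op (toT α s) • q :=
  rfl

/-- The `S`-linear map `S → T / I`. -/
def toTQuotient (I : Submodule (TRing α)ᵐᵒᵖ (TRing α)) :
    SRing α →ₗ[(SRing α)ᵐᵒᵖ] TRing α ⧸ I where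
  toFun s := Submodule.Quotient.mk (toT α s)
  map_add' a b := by
    rw [map_add]
    rfl
  map_smul' a b := by
    rw [RingHom.id_apply, smul_eq_mul_unop, map_mul]
    rfl

include hres in
theorem ker_toTQuotient (hx : IsLocalRing.maximalIdeal R = Ideal.span {x}) {z : SRing α}
    (hz : z ∉ rightIdeal (inS α x)) :
    LinearMap.ker (toTQuotient α (rightIdeal (toT α z))) = rightIdeal z := by
  ext s
  rw [← toT_mem_rightIdeal_iff hres α hx hz]
  exact Submodule.Quotient.mk_eq_zero _

include hres in
theorem nonempty_quotient_equiv_of_surjective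
    (hx : IsLocalRing.maximalIdeal R = Ideal.span {x}) {z : SRing α}
    (hz : z ∉ rightIdeal (inS α x))
    (h : Function.Surjective (toTQuotient α (rightIdeal (toT α z)))) :
    Nonempty ((SRing α ⧸ rightIdeal z) ≃ₗ[(SRing α)ᵐᵒᵖ] (TRing α ⧸ rightIdeal (toT α z))) :=
  ⟨(Submodule.quotEquivOfEq _ _ (ker_toTQuotient hres α hx hz).symm).trans
    (LinearMap.quotKerEquivOfSurjective _ h)⟩

theorem not_mem_of_isUnit_red (hx : IsLocalRing.maximalIdeal R = Ideal.span {x}) {z : SRing α}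
    (hz : IsUnit (red hres α z)) : z ∉ rightIdeal (inS α x) := fun h =>
  hz.ne_zero ((red_eq_zero_iff hres α hx).2 h)

/-- If `z` is invertible modulo `x`, then `S = z S + S xⁿ` for all `n`. -/
theorem exists_eq_mul_add_mul_pow (hx : IsLocalRing.maximalIdeal R = Ideal.span {x})
    {z : SRing α} (hz : IsUnit (red hres α z)) (n : ℕ) (s : SRing α) :
    ∃ a b, s = z * a + b * inS α x ^ n := by
  induction n generalizing s with
  | zero => exact ⟨0, s, by simp⟩
  | succ n ih =>
    obtain ⟨q, hq⟩ := hz.exists_right_inv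
    have h : s - z * polyToS α (q * red hres α s) ∈ rightIdeal (inS α x) := by
      rw [← red_eq_zero_iff hres α hx, map_sub, map_mul, red_polyToS, ← mul_assoc, hq, one_mul,
        sub_self]
    obtain ⟨b, hb⟩ := exists_eq_mul_uniformizer α hx h
    obtain ⟨a', b', rfl⟩ := ih b
    refine ⟨polyToS α (q * red hres α s) + a' * inS α x, b',
      (sub_eq_iff_eq_add'.1 hb).trans ?_⟩
    rw [mul_add, add_mul, pow_succ]
    simp only [mul_assoc, add_assoc]

theorem nonempty_quotient_equiv_of_isUnit_red
    (hx : IsLocalRing.maximalIdeal R = Ideal.span {x}) {z : SRing α}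
    (hz : IsUnit (red hres α z)) :
    Nonempty ((SRing α ⧸ rightIdeal z) ≃ₗ[(SRing α)ᵐᵒᵖ] (TRing α ⧸ rightIdeal (toT α z))) := by
  refine nonempty_quotient_equiv_of_surjective hres α hx
    (not_mem_of_isUnit_red hres α hx hz) fun q => ?_
  obtain ⟨t, rfl⟩ := Submodule.Quotient.mk_surjective _ q
  obtain ⟨n, s, hs⟩ := exists_mul_pow_eq_toT α x hx t
  obtain ⟨a, b, rfl⟩ := exists_eq_mul_add_mul_pow hres α hx hz n s
  refine ⟨b, ((Submodule.Quotient.eq _).2 ?_).symm⟩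
  obtain ⟨w, hw⟩ := ((isUnit_toT_inS α x (irreducible_uniformizer hx).ne_zero).pow n)
  rw [map_add, map_mul, map_mul, map_pow, ← hw] at hs
  refine mem_rightIdeal.2 ⟨toT α a * (↑w⁻¹ : TRing α), ?_⟩
  rw [← mul_assoc, ← sub_eq_iff_eq_add.2 hs, sub_mul, mul_assoc, mul_assoc, w.mul_inv, mul_one,
    mul_one]

/-- If the uniformizer acts surjectively on `S / z S`, then `S = z S + x S`, so that `z` is
invertible modulo `x`. -/
theorem isUnit_red_of_smul_surjective (hx : IsLocalRing.maximalIdeal R = Ideal.span {x})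
    {z : SRing α}
    (h : Function.Surjective fun v : SRing α ⧸ rightIdeal z => op (inS α x) • v) :
    IsUnit (red hres α z) := by
  obtain ⟨q, hq⟩ := h (Submodule.Quotient.mk 1)
  obtain ⟨b, rfl⟩ := Submodule.Quotient.mk_surjective _ q
  obtain ⟨a, ha⟩ := mem_rightIdeal.1 ((Submodule.Quotient.eq _).1 hq.symm)
  refine IsUnit.of_mul_eq_one (red hres α a) ?_
  rw [← map_mul, ha, map_sub, map_one]
  change _ - red hres α (b * inS α x) = 1
  rw [map_mul, red_C, (resHom_eq_zero_iff hres hx x).2 dvd_rfl]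
  simp

/-! ### Type (B) elements -/

theorem IsTypeB.isUnit_red (hx : IsLocalRing.maximalIdeal R = Ideal.span {x}) {z : SRing α}
    (hz : IsTypeB α x z) : IsUnit (red hres α z) := by
  obtain ⟨-, u, s, -, hu⟩ := hz
  have h := congrArg (red hres α) hu
  rw [map_mul, map_add, map_mul, red_C, (resHom_eq_zero_iff hres hx x).2 dvd_rfl] at h
  exact IsUnit.of_mul_eq_one_right _ (by simpa using h)

theorem isTypeB_of_isUnit_red (hx : IsLocalRing.maximalIdeal R = Ideal.span {x}) {z : SRing α}
    (hz : Irreducible z) (h : IsUnit (red hres α z)) : IsTypeB α x z := by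
  obtain ⟨c, hc, hcz⟩ := Polynomial.isUnit_iff.1 h
  have hu : IsUnit (inS α (algebraMap k R c⁻¹)) :=
    ((hc.ne_zero.isUnit.inv).map (algebraMap k R)).map (C (α : R ≃+* R))
  obtain ⟨u, hu⟩ := hu
  have h1 : (u : SRing α) * z - 1 ∈ rightIdeal (inS α x) := by
    rw [← red_eq_zero_iff hres α hx, map_sub, map_mul, hu, red_C, resHom_algebraMap, ← hcz,
      ← Polynomial.C_mul, inv_mul_cancel₀ hc.ne_zero, map_one, map_one, sub_self]
  obtain ⟨s, hs⟩ := mem_rightIdeal.1 h1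
  have h2 : (u : SRing α) * z = 1 + inS α x * s := by rw [hs, add_sub_cancel]
  refine ⟨hz, u, s, ?_, h2⟩
  rintro ⟨r, rfl⟩
  -- otherwise `u z = 1 + x r` would be a unit of the local ring `R`
  have h3 : IsUnit (1 + x * r) := by
    have hxm : -(x * r) ∈ IsLocalRing.maximalIdeal R := by
      rw [hx]
      exact neg_mem (Ideal.mul_mem_right _ _ (Ideal.mem_span_singleton_self x))
    simpa using IsLocalRing.isUnit_one_sub_self_of_mem_nonunits _ hxm
  have h4 : IsUnit ((u : SRing α) * z) := by
    rw [h2, ← map_mul, ← map_one (C (α : R ≃+* R)), ← map_add]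
    exact h3.map _
  exact hz.not_isUnit ((Units.isUnit_units_mul u z).1 h4)

end Setting

end

noncomputable section

section Setting

open MulOpposite SkewPoly

variable {k : Type*} [Field k] {R : Type*} [CommRing R] [IsDomain R] [Algebra k R]
  (α : R ≃ₐ[k] R) {V : Type*} [AddCommGroup V] [Module (SRing α)ᵐᵒᵖ V]

/-! ### Simple modules that are not faithful -/

/-- When `σ` has infinite order, an element of least degree in a nonzero two-sided ideal of
`A[θ; σ]` is a monomial: for such a `p`, of degree `n`, the degree of `p r - σⁿ(r) p` is smaller. -/
theorem SkewPoly.exists_term_of_not_faithfulSMul {A : Type*} [CommRing A] [IsDomain A]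
    {σ : A ≃+* A} (hσ : ∀ n : ℕ, 0 < n → (σ : RingAut A) ^ n ≠ 1) {V : Type*} [AddCommGroup V]
    [Module (SkewPoly σ)ᵐᵒᵖ V] (hV : ¬ FaithfulSMul (SkewPoly σ)ᵐᵒᵖ V) :
    ∃ (a : A) (n : ℕ), a ≠ 0 ∧ ∀ v : V, op (C σ a * θ σ ^ n) • v = 0 := by
  classical
  rw [faithfulSMul_op_iff] at hV
  push Not at hV
  obtain ⟨p₀, hp₀, hp₀'⟩ := hV
  obtain ⟨n₀, hn₀⟩ := exists_degLT p₀
  have hex : ∃ n, ∃ p : SkewPoly σ, (∀ v : V, op p • v = 0) ∧ p ≠ 0 ∧ DegLT n p :=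
    ⟨n₀, p₀, hp₀, hp₀', hn₀⟩
  obtain ⟨p, hp, hp0, hdeg⟩ := Nat.find_spec hex
  have hmin : ∀ m < Nat.find hex, ∀ q : SkewPoly σ, (∀ v : V, op q • v = 0) → DegLT m q → q = 0 :=
    fun m hm q hq hqd => by
      by_contra hq0
      exact Nat.find_min hex hm ⟨q, hq, hq0, hqd⟩
  obtain ⟨n, hn⟩ : ∃ n, Nat.find hex = n + 1 := by
    refine Nat.exists_eq_succ_of_ne_zero fun h0 => hp0 ?_
    rw [h0] at hdeg
    exact hdeg.eq_zero
  rw [hn] at hdeg hmin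
  have hlead : coeffHom σ n p ≠ 0 := fun h => hp0 (hmin n (by omega) p hp (hdeg.of_succ h))
  have hcomm : ∀ r : A, p * C σ r - C σ ((σ ^ n : RingAut A) r) * p = 0 := fun r => by
    refine hmin n (by omega) _ (fun v => ?_) ?_
    · rw [op_sub, op_mul, op_mul, sub_smul, mul_smul, mul_smul, hp, hp, smul_zero, sub_zero]
    · intro m hm
      rw [map_sub, coeffHom_mul_C, coeffHom_C_mul]
      rcases hm.eq_or_lt with rfl | hm
      · ring
      · rw [hdeg m hm, zero_mul, mul_zero, sub_zero]
  have hzero : ∀ i < n, coeffHom σ i p = 0 := fun i hi => by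
    by_contra hi0
    refine hσ (n - i) (by omega) (RingEquiv.ext fun r => ?_)
    have h1 := congrArg (coeffHom σ i) (hcomm r)
    rw [map_sub, coeffHom_mul_C, coeffHom_C_mul, map_zero, mul_comm, ← sub_mul] at h1
    have h2 := sub_eq_zero.1 ((mul_eq_zero.1 h1).resolve_right hi0)
    rw [show n = i + (n - i) by omega, pow_add] at h2
    exact ((σ ^ i : RingAut A).injective h2).symm
  refine ⟨coeffHom σ n p, n, hlead, ?_⟩
  have hterm : C σ (coeffHom σ n p) * θ σ ^ n = p := by
    refine ext_coeffHom fun m => ?_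
    rw [coeffHom_term]
    rcases lt_trichotomy n m with h | h | h
    · rw [if_neg h.ne, hdeg m h]
    · rw [if_pos h, h]
    · rw [if_neg h.ne', hzero m h]
  rwa [hterm]

omit [IsDomain R] in
theorem toRingAut_pow_ne_one (hα : ∀ n : ℕ, 0 < n → α ^ n ≠ 1) (n : ℕ) (hn : 0 < n) :
    ((α : R ≃+* R) : RingAut R) ^ n ≠ 1 := fun h => hα n hn (AlgEquiv.ext fun r => by
  have hpow : ∀ (m : ℕ) (r : R), ((α : R ≃+* R) ^ m : RingAut R) r = (α ^ m) r := fun m => by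
    induction m with
    | zero => exact fun r => rfl
    | succ m ih =>
      intro r
      rw [pow_succ, pow_succ]
      exact ih (α r)
  rw [← hpow, h]
  rfl)

variable [IsDiscreteValuationRing R] {x : R}

theorem op_pow_smul_bijective {D : Type*} [Ring D] {V : Type*} [AddCommGroup V] [Module Dᵐᵒᵖ V]
    {s : D} (h : Function.Bijective fun v : V => op s • v) (n : ℕ) :
    Function.Bijective fun v : V => op (s ^ n) • v := by
  induction n with
  | zero =>
    simp only [pow_zero, op_one, one_smul]
    exact Function.bijective_id
  | succ n ih =>
    have : (fun v : V => op (s ^ (n + 1)) • v) = (fun v : V => op s • v) ∘ fun v => op (s ^ n) • v :=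
      funext fun v => by simp [pow_succ, mul_smul]
    rw [this]
    exact h.comp ih

/-- A simple module killed by `θ` is killed by the uniformizer: it is a simple `R`-module, so that
Nakayama's lemma applies. -/
theorem uniformizer_smul_eq_zero_of_θ_smul_eq_zero [IsSimpleModule (SRing α)ᵐᵒᵖ V]
    (hx : IsLocalRing.maximalIdeal R = Ideal.span {x})
    (hθ : ∀ v : V, op (θ (α : R ≃+* R)) • v = 0) (v : V) : op (inS α x) • v = 0 := by
  refine (isNormalElement_uniformizer α hx).smul_eq_zero_or_bijective.resolve_right
    (fun hbij => ?_) v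
  obtain ⟨v, hv⟩ := exists_ne_zero_of_isSimpleModule (SRing α) V
  have hconst : ∀ s : SRing α, ∃ r : R, op s • v = op (inS α r) • v := by
    intro s
    induction s using ind with
    | h0 => exact ⟨0, by simp⟩
    | h1 n a =>
      rcases n with _ | n
      · exact ⟨a, by simp⟩
      · refine ⟨0, ?_⟩
        rw [pow_succ, ← mul_assoc, op_mul, mul_smul, hθ]
        simp
    | ha f g hf hg =>
      obtain ⟨a, ha⟩ := hf
      obtain ⟨b, hb⟩ := hg
      exact ⟨a + b, by rw [op_add, add_smul, ha, hb, ← add_smul, ← op_add, ← map_add]⟩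
  obtain ⟨w, hw⟩ := hbij.2 v
  obtain ⟨s, rfl⟩ := orbitMap_surjective (D := SRing α) hv w
  obtain ⟨r, hr⟩ := hconst s
  dsimp only at hw
  rw [orbitMap_apply, hr, smul_smul, ← op_mul, ← map_mul] at hw
  have hunit : IsUnit (1 - r * x) := by
    refine IsLocalRing.isUnit_one_sub_self_of_mem_nonunits _ ?_
    change r * x ∈ IsLocalRing.maximalIdeal R
    rw [hx]
    exact Ideal.mul_mem_left _ _ (Ideal.mem_span_singleton_self x)
  obtain ⟨c, hc⟩ := hunit.exists_right_inv
  have h0 : op (C (α : R ≃+* R) (1 - r * x)) • v = 0 := by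
    rw [map_sub, op_sub, sub_smul, hw, map_one, op_one, one_smul, sub_self]
  refine hv ?_
  rw [← one_smul (SRing α)ᵐᵒᵖ v, ← op_one, ← map_one (C (α : R ≃+* R)), ← hc, map_mul, op_mul,
    mul_smul, h0, smul_zero]

theorem uniformizer_smul_eq_zero_of_not_faithfulSMul [IsSimpleModule (SRing α)ᵐᵒᵖ V]
    (hx : IsLocalRing.maximalIdeal R = Ideal.span {x}) (hα : ∀ n : ℕ, 0 < n → α ^ n ≠ 1)
    (hV : ¬ FaithfulSMul (SRing α)ᵐᵒᵖ V) (v : V) : op (inS α x) • v = 0 := by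
  obtain ⟨a, n, ha, hkill⟩ := exists_term_of_not_faithfulSMul (toRingAut_pow_ne_one α hα) hV
  refine (isNormalElement_uniformizer α hx).smul_eq_zero_or_bijective.resolve_right
    (fun hbij => ?_) v
  obtain ⟨v, hv⟩ := exists_ne_zero_of_isSimpleModule (SRing α) V
  obtain ⟨m, u, rfl⟩ :=
    IsDiscreteValuationRing.eq_unit_mul_pow_irreducible ha (irreducible_uniformizer hx)
  -- `u xᵐ` acts surjectively, so `θⁿ` acts as zero
  have hθn : ∀ w : V, op (θ (α : R ≃+* R) ^ n) • w = 0 := fun w => by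
    obtain ⟨w', rfl⟩ := (op_pow_smul_bijective hbij m).2 w
    have h := hkill (op (inS α (↑u⁻¹ : R)) • w')
    rwa [smul_smul, ← op_mul, ← mul_assoc, ← map_mul, ← mul_assoc, u.inv_mul, one_mul, op_mul,
      mul_smul, map_pow] at h
  rcases (isNormalElement_θ α).smul_eq_zero_or_bijective (V := V) with hθ | hθ
  · obtain ⟨w, hw⟩ := hbij.2 v
    exact hv (hw ▸ uniformizer_smul_eq_zero_of_θ_smul_eq_zero α hx hθ w)
  · exact hv ((op_pow_smul_bijective hθ n).1 ((hθn v).trans (hθn 0).symm))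

theorem not_faithfulSMul_of_uniformizer_smul_eq_zero
    (hx : IsLocalRing.maximalIdeal R = Ideal.span {x})
    (h : ∀ v : V, op (inS α x) • v = 0) : ¬ FaithfulSMul (SRing α)ᵐᵒᵖ V := fun hf =>
  inS_uniformizer_ne_zero α hx (faithfulSMul_op_iff.1 hf _ h)

theorem uniformizer_smul_bijective_of_faithfulSMul [IsSimpleModule (SRing α)ᵐᵒᵖ V]
    (hx : IsLocalRing.maximalIdeal R = Ideal.span {x}) (hV : FaithfulSMul (SRing α)ᵐᵒᵖ V) :
    Function.Bijective fun v : V => op (inS α x) • v :=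
  (isNormalElement_uniformizer α hx).smul_eq_zero_or_bijective.resolve_left fun h =>
    not_faithfulSMul_of_uniformizer_smul_eq_zero α hx h hV

theorem not_faithfulSMul_iff_isXTorsion [IsSimpleModule (SRing α)ᵐᵒᵖ V]
    (hx : IsLocalRing.maximalIdeal R = Ideal.span {x}) (hα : ∀ n : ℕ, 0 < n → α ^ n ≠ 1) :
    ¬ FaithfulSMul (SRing α)ᵐᵒᵖ V ↔ IsXTorsion α x V := by
  constructor
  · intro h v
    exact ⟨1, by rw [pow_one]; exact uniformizer_smul_eq_zero_of_not_faithfulSMul α hx hα h v⟩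
  · intro h hf
    obtain ⟨v, hv⟩ := exists_ne_zero_of_isSimpleModule (SRing α) V
    obtain ⟨n, hn⟩ := h v
    have hbij := op_pow_smul_bijective (uniformizer_smul_bijective_of_faithfulSMul α hx hf) n
    exact hv (hbij.1 (hn.trans (smul_zero _).symm))

/-! ### The modules `V_f` -/

variable (hres : Function.Bijective (algebraMap k (IsLocalRing.ResidueField R)))
  (hx : IsLocalRing.maximalIdeal R = Ideal.span {x})

include hres hx

theorem red_uniformizer : red hres α (inS α x) = 0 :=
  (red_eq_zero_iff hres α hx).2 (self_mem_rightIdeal _)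

theorem mem_iff_dvd_red {f : k[X]} {a : SRing α} :
    a ∈ rightIdeal (inS α x) ⊔ rightIdeal (polyToS α f) ↔ f ∣ red hres α a := by
  constructor
  · intro h
    obtain ⟨b, hb, c, hc, rfl⟩ := Submodule.mem_sup.1 h
    obtain ⟨s, rfl⟩ := mem_rightIdeal.1 hc
    rw [map_add, (red_eq_zero_iff hres α hx).2 hb, zero_add, map_mul, red_polyToS]
    exact dvd_mul_right _ _
  · rintro ⟨q, hq⟩
    have h1 : a - polyToS α f * polyToS α q ∈ rightIdeal (inS α x) := by
      rw [← red_eq_zero_iff hres α hx, map_sub, map_mul, red_polyToS, red_polyToS, hq, sub_self]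
    rw [← sub_add_cancel a (polyToS α f * polyToS α q)]
    exact add_mem (Submodule.mem_sup_left h1) (Submodule.mem_sup_right (mem_rightIdeal.2 ⟨_, rfl⟩))

theorem isSimpleModule_VMod {f : k[X]} (hf : Irreducible f) :
    IsSimpleModule (SRing α)ᵐᵒᵖ (VMod α x f) := by
  rw [quotient_isSimpleModule_iff, isCoatom_iff_exists_one_sub_mem]
  simp only [mem_iff_dvd_red α hres hx]
  refine ⟨fun h => hf.not_isUnit (isUnit_of_dvd_one (by rwa [map_one] at h)), fun a ha => ?_⟩
  obtain ⟨p, q, hpq⟩ := (hf.coprime_iff_not_dvd).2 ha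
  refine ⟨polyToS α q, p, ?_⟩
  rw [map_sub, map_one, map_mul, red_polyToS]
  linear_combination -hpq

theorem uniformizer_smul_VMod (f : k[X]) (v : VMod α x f) : op (inS α x) • v = 0 := by
  obtain ⟨s, rfl⟩ := Submodule.Quotient.mk_surjective _ v
  refine (Submodule.Quotient.mk_eq_zero _).2 ((mem_iff_dvd_red α hres hx).2 ?_)
  change f ∣ red hres α (s * inS α x)
  rw [map_mul, red_uniformizer α hres hx, mul_zero]
  exact dvd_zero f

theorem polyToS_smul_VMod (f : k[X]) (v : VMod α x f) : op (polyToS α f) • v = 0 := by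
  obtain ⟨s, rfl⟩ := Submodule.Quotient.mk_surjective _ v
  refine (Submodule.Quotient.mk_eq_zero _).2 ((mem_iff_dvd_red α hres hx).2 ?_)
  change f ∣ red hres α (s * polyToS α f)
  rw [map_mul, red_polyToS]
  exact dvd_mul_left _ _

theorem nonempty_VMod_equiv_iff {f g : k[X]} (hf : f.Monic) (hg : g.Monic)
    (hg' : Irreducible g) (hf' : Irreducible f) :
    Nonempty (VMod α x f ≃ₗ[(SRing α)ᵐᵒᵖ] VMod α x g) ↔ f = g := by
  constructor
  · rintro ⟨e⟩
    have h0 : op (polyToS α f) • (Submodule.Quotient.mk 1 : VMod α x g) = 0 := by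
      rw [← e.apply_symm_apply (Submodule.Quotient.mk 1), ← map_smul,
        polyToS_smul_VMod α hres hx, map_zero]
    have h1 : g ∣ red hres α (1 * polyToS α f) :=
      (mem_iff_dvd_red α hres hx).1 ((Submodule.Quotient.mk_eq_zero _).1 h0)
    rw [one_mul, red_polyToS] at h1
    exact eq_of_monic_of_associated hf hg (hg'.associated_of_dvd hf' h1).symm
  · rintro rfl
    exact ⟨LinearEquiv.refl _ _⟩

/-- A simple module killed by the uniformizer is a simple module over `S / x S = k[X]`. -/
theorem exists_VMod_equiv [IsSimpleModule (SRing α)ᵐᵒᵖ V] (h : ∀ v : V, op (inS α x) • v = 0) :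
    ∃ f : k[X], f.Monic ∧ Irreducible f ∧ Nonempty (V ≃ₗ[(SRing α)ᵐᵒᵖ] VMod α x f) := by
  classical
  obtain ⟨v, hv⟩ := exists_ne_zero_of_isSimpleModule (SRing α) V
  have hsurj := orbitMap_surjective (D := SRing α) hv
  set J := LinearMap.ker (orbitMap (D := SRing α) v) with hJ
  let e : (SRing α ⧸ J) ≃ₗ[(SRing α)ᵐᵒᵖ] V := LinearMap.quotKerEquivOfSurjective _ hsurj
  have hco : IsCoatom J := quotient_isSimpleModule_iff.1 (IsSimpleModule.congr e)
  obtain ⟨h1, h2⟩ := isCoatom_iff_exists_one_sub_mem.1 hco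
  have hxJ : ∀ s, red hres α s = 0 → s ∈ J := fun s hs => by
    obtain ⟨b, rfl⟩ := exists_eq_mul_uniformizer α hx ((red_eq_zero_iff hres α hx).1 hs)
    rw [hJ, LinearMap.mem_ker, orbitMap_apply, op_mul, mul_smul, h]
  let L : Ideal k[X] :=
    { carrier := {p | ∀ s, red hres α s = p → s ∈ J}
      add_mem' := fun {p q} hp hq s hs => by
        have := add_mem (hp _ (red_polyToS hres α p)) (hq _ (red_polyToS hres α q))
        rw [← sub_add_cancel s (polyToS α p + polyToS α q)]
        refine add_mem (hxJ _ ?_) this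
        rw [map_sub, map_add, red_polyToS, red_polyToS, hs, sub_self]
      zero_mem' := hxJ
      smul_mem' := fun c p hp s hs => by
        have := mul_mem_right (hp _ (red_polyToS hres α p)) (polyToS α c)
        rw [← sub_add_cancel s (polyToS α p * polyToS α c)]
        refine add_mem (hxJ _ ?_) this
        rw [map_sub, map_mul, red_polyToS, red_polyToS, hs, smul_eq_mul, mul_comm, sub_self] }
  have hL : ∀ s, s ∈ J ↔ red hres α s ∈ L := fun s => by
    refine ⟨fun hs t ht => ?_, fun hs => hs s rfl⟩
    rw [← sub_add_cancel t s]
    exact add_mem (hxJ _ (by rw [map_sub, ht, sub_self])) hs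
  have hLmax : L.IsMaximal := by
    refine Ideal.isMaximal_iff.2 ⟨fun h => h1 ((hL 1).2 (by rwa [map_one])), ?_⟩
    intro M p hLM hpL hpM
    obtain ⟨b, hb⟩ := h2 (polyToS α p) fun hp => hpL (by
      rwa [hL, red_polyToS] at hp)
    rw [hL, map_sub, map_one, map_mul, red_polyToS] at hb
    simpa using M.add_mem (hLM hb) (M.mul_mem_right (red hres α b) hpM)
  obtain ⟨g, hg⟩ := (IsPrincipalIdealRing.principal L).1
  rw [Ideal.submodule_span_eq] at hg
  have hg0 : g ≠ 0 := by
    rintro rfl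
    refine Ring.ne_bot_of_isMaximal_of_not_isField hLmax (Polynomial.not_isField k) ?_
    rw [hg]
    simp
  have hgirr : Irreducible g := by
    refine ((Ideal.span_singleton_prime hg0).1 ?_).irreducible
    rw [← hg]
    exact hLmax.isPrime
  have hassoc : Associated (normalize g) g := normalize_associated g
  refine ⟨normalize g, monic_normalize hg0, hassoc.symm.irreducible hgirr,
    ⟨e.symm.trans (Submodule.quotEquivOfEq _ _ ?_)⟩⟩
  ext s
  rw [hL, mem_iff_dvd_red α hres hx, hg, Ideal.mem_span_singleton]
  exact hassoc.symm.dvd_iff_dvd_left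

/-! ### Faithful simple modules -/

theorem irreducible_and_isUnit_red_of_faithfulSMul {z : SRing α}
    (hs : IsSimpleModule (SRing α)ᵐᵒᵖ (SRing α ⧸ rightIdeal z))
    (hf : FaithfulSMul (SRing α)ᵐᵒᵖ (SRing α ⧸ rightIdeal z)) :
    Irreducible z ∧ IsUnit (red hres α z) := by
  have hu : IsUnit (red hres α z) := isUnit_red_of_smul_surjective hres α hx
    (uniformizer_smul_bijective_of_faithfulSMul α hx hf).2
  refine ⟨irreducible_of_isCoatom ?_ (quotient_isSimpleModule_iff.1 hs), hu⟩
  rintro rfl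
  simp at hu

theorem isSimpleModule_quotient {z : SRing α} (hz : IsUnit (red hres α z))
    (hT : Irreducible (toT α z)) : IsSimpleModule (SRing α)ᵐᵒᵖ (SRing α ⧸ rightIdeal z) := by
  have hzx := not_mem_of_isUnit_red hres α hx hz
  rw [quotient_isSimpleModule_iff, isCoatom_iff_exists_one_sub_mem]
  have hco := isCoatom_iff_exists_one_sub_mem.1 (isCoatom_of_irreducible exists_eq_rightIdeal hT)
  refine ⟨fun h => hco.1 ?_, fun a ha => ?_⟩
  · rwa [← toT_mem_rightIdeal_iff hres α hx hzx, map_one] at h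
  · obtain ⟨t, ht⟩ := hco.2 (toT α a) (by rwa [toT_mem_rightIdeal_iff hres α hx hzx])
    obtain ⟨n, s, hs⟩ := exists_mul_pow_eq_toT α x hx t
    -- clearing denominators, `xⁿ ∈ z S + a S`
    have h1 : inS α x ^ n - a * s ∈ rightIdeal z := by
      rw [← toT_mem_rightIdeal_iff hres α hx hzx, map_sub, map_mul, ← hs, map_pow, ← mul_assoc]
      simpa [sub_mul] using mul_mem_right ht (toT α (inS α x) ^ n)
    obtain ⟨c, d, hcd⟩ := exists_eq_mul_add_mul_pow hres α hx hz n 1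
    obtain ⟨d', hd'⟩ := ((isNormalElement_uniformizer α hx).pow n).exists_eq_mul d
    refine ⟨s * d', ?_⟩
    have h2 : 1 - a * (s * d') = z * c + (inS α x ^ n - a * s) * d' := by
      nth_rewrite 1 [hcd]
      rw [hd', sub_mul, mul_assoc, add_sub_assoc]
    rw [h2]
    exact add_mem (mem_rightIdeal.2 ⟨c, rfl⟩) (mul_mem_right h1 d')

theorem faithfulSMul_quotient (hα : ∀ n : ℕ, 0 < n → α ^ n ≠ 1) {z : SRing α}
    (hz : IsUnit (red hres α z)) (hT : Irreducible (toT α z)) :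
    FaithfulSMul (SRing α)ᵐᵒᵖ (SRing α ⧸ rightIdeal z) := by
  have := isSimpleModule_quotient α hres hx hz hT
  by_contra hf
  have hkill := uniformizer_smul_eq_zero_of_not_faithfulSMul α hx hα hf
  obtain ⟨v, hv⟩ := exists_ne_zero_of_isSimpleModule (SRing α) (SRing α ⧸ rightIdeal z)
  obtain ⟨s, rfl⟩ := Submodule.Quotient.mk_surjective _ v
  obtain ⟨a, b, rfl⟩ := exists_eq_mul_add_mul_pow hres α hx hz 1 s
  refine hv ?_
  rw [Submodule.Quotient.mk_add, (Submodule.Quotient.mk_eq_zero _).2 (mem_rightIdeal.2 ⟨a, rfl⟩),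
    zero_add, pow_one]
  exact hkill (Submodule.Quotient.mk b)

/-- If `S / z S` is a simple `S`-module, then `T / z T` is a simple `T`-module: multiplied by a
power of the uniformizer, an element of `T` outside `z T` becomes an element of `S` outside
`z S`. -/
theorem isCoatom_rightIdeal_toT {z : SRing α} (hzx : z ∉ rightIdeal (inS α x))
    (h : IsCoatom (rightIdeal z)) : IsCoatom (rightIdeal (toT α z)) := by
  obtain ⟨h1, h2⟩ := isCoatom_iff_exists_one_sub_mem.1 h
  refine isCoatom_iff_exists_one_sub_mem.2 ⟨fun h => h1 ?_, fun t ht => ?_⟩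
  · rwa [← toT_mem_rightIdeal_iff hres α hx hzx, map_one]
  · obtain ⟨n, s, hs⟩ := exists_mul_pow_eq_toT α x hx t
    obtain ⟨b, hb⟩ := h2 s fun hsz => ht (by
      rw [← toT_mem_rightIdeal_iff hres α hx hzx, ← hs] at hsz
      obtain ⟨w, hw⟩ := (isUnit_toT_inS α x (irreducible_uniformizer hx).ne_zero).pow n
      have := mul_mem_right hsz (↑w⁻¹ : TRing α)
      rwa [← hw, mul_assoc, w.mul_inv, mul_one] at this)
    refine ⟨toT α (inS α x) ^ n * toT α b, ?_⟩
    rwa [← mul_assoc, hs, ← map_mul, ← map_one (toT α), ← map_sub,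
      toT_mem_rightIdeal_iff hres α hx hzx]

omit hres in
/-- A nonzero right ideal of `T` is generated by an element of `S` outside `x S`. -/
theorem exists_eq_rightIdeal_toT {J : Submodule (TRing α)ᵐᵒᵖ (TRing α)} (hJ : J ≠ ⊥) :
    ∃ z : SRing α, z ∉ rightIdeal (inS α x) ∧ J = rightIdeal (toT α z) := by
  obtain ⟨w, rfl⟩ := exists_eq_rightIdeal J
  have hw : w ≠ 0 := by
    rintro rfl
    simp at hJ
  obtain ⟨n, s, hs⟩ := exists_mul_pow_eq_toT α x hx w
  have hunit := isUnit_toT_inS α x (irreducible_uniformizer hx).ne_zero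
  have hs0 : s ≠ 0 := by
    rintro rfl
    rw [map_zero] at hs
    exact hw ((hunit.pow n).mul_left_eq_zero.1 hs)
  obtain ⟨m, z, rfl, hz⟩ := exists_eq_mul_pow α hx hs0
  refine ⟨z, hz, ?_⟩
  obtain ⟨p, hp⟩ := hunit.pow n
  obtain ⟨q, hq⟩ := hunit.pow m
  rw [map_mul, map_pow, ← hp, ← hq] at hs
  refine le_antisymm (rightIdeal_le_iff.2 (mem_rightIdeal.2 ⟨q * (↑p⁻¹ : TRing α), ?_⟩))
    (rightIdeal_le_iff.2 (mem_rightIdeal.2 ⟨p * (↑q⁻¹ : TRing α), ?_⟩))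
  · rw [← mul_assoc, ← hs, mul_assoc, p.mul_inv, mul_one]
  · rw [← mul_assoc, hs, mul_assoc, q.mul_inv, mul_one]

/-- The annihilator in `T` of an element `v` of a module on which the uniformizer acts
injectively: `t` belongs to it if `v s = 0` for some `s = t xⁿ` in `S`. -/
def annihilatorT (hx : IsLocalRing.maximalIdeal R = Ideal.span {x}) (v : V) :
    Submodule (TRing α)ᵐᵒᵖ (TRing α) where
  carrier := {t | ∃ n s, t * toT α (inS α x) ^ n = toT α s ∧ op s • v = 0}
  zero_mem' := ⟨0, 0, by simp, by simp⟩
  add_mem' := by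
    rintro a b ⟨n, s, hs, hs0⟩ ⟨m, r, hr, hr0⟩
    refine ⟨n + m, s * inS α x ^ m + r * inS α x ^ n, ?_, ?_⟩
    · rw [map_add, map_mul, map_mul, ← hs, ← hr, map_pow, map_pow, add_mul, mul_assoc, mul_assoc,
        ← pow_add, ← pow_add, add_comm m n]
    · rw [op_add, add_smul, op_mul, op_mul, mul_smul, mul_smul, hs0, hr0, smul_zero, smul_zero,
        add_zero]
  smul_mem' := by
    rintro c t ⟨n, s, hs, hs0⟩
    obtain ⟨m, r, hr⟩ := exists_mul_pow_eq_toT α x hx c.unop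
    obtain ⟨r', hr'⟩ := ((isNormalElement_uniformizer α hx).pow n).exists_eq_mul r
    refine ⟨m + n, s * r', ?_, ?_⟩
    · rw [smul_eq_mul_unop, pow_add, mul_assoc, ← mul_assoc c.unop, hr, ← map_pow, ← map_mul, hr',
        map_mul, map_pow, ← mul_assoc, hs, map_mul]
    · rw [op_mul, mul_smul, hs0, smul_zero]

omit hres in
theorem toT_mem_annihilatorT (hinj : Function.Injective fun v : V => op (inS α x) • v) (v : V)
    (s : SRing α) : toT α s ∈ annihilatorT α hx v ↔ op s • v = 0 := by
  constructor
  · rintro ⟨n, r, hr, hr0⟩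
    rw [← map_pow, ← map_mul] at hr
    rw [← toT_injective α hr, op_mul, mul_smul] at hr0
    clear hr
    induction n with
    | zero => simpa using hr0
    | succ n ih =>
      refine ih (hinj ?_)
      dsimp only
      rwa [smul_zero, smul_smul, ← op_mul, ← pow_succ]
  · exact fun h => ⟨0, s, by simp, h⟩

/-- A faithful simple module `V` has the form `S / z S`: the annihilator in `T` of a nonzero
element is a right ideal `z T` with `z ∈ S` outside `x S`, and `z T ∩ S = z S`. -/
theorem exists_quotient_equiv_of_faithfulSMul [IsSimpleModule (SRing α)ᵐᵒᵖ V]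
    (hV : FaithfulSMul (SRing α)ᵐᵒᵖ V) :
    ∃ z : SRing α, z ∉ rightIdeal (inS α x) ∧
      Nonempty (V ≃ₗ[(SRing α)ᵐᵒᵖ] (SRing α ⧸ rightIdeal z)) := by
  have hbij := uniformizer_smul_bijective_of_faithfulSMul α hx hV
  obtain ⟨v, hv⟩ := exists_ne_zero_of_isSimpleModule (SRing α) V
  have hmem := toT_mem_annihilatorT α hx hbij.1 v
  have hJ : annihilatorT α hx v ≠ ⊥ := fun h => by
    rw [h] at hmem
    -- otherwise `s ↦ v s` is injective, while `v = v s x` for some `s`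
    obtain ⟨w, hw⟩ := hbij.2 v
    obtain ⟨s, rfl⟩ := orbitMap_surjective (D := SRing α) hv w
    have h0 : op (s * inS α x - 1) • v = 0 := by
      rw [op_sub, sub_smul, op_mul, mul_smul, op_one, one_smul]
      exact sub_eq_zero.2 hw
    rw [← hmem, Submodule.mem_bot, map_eq_zero_iff _ (toT_injective α), sub_eq_zero] at h0
    have h1 := congrArg (red hres α) h0
    rw [map_mul, red_uniformizer α hres hx, mul_zero, map_one] at h1
    exact zero_ne_one h1
  obtain ⟨z, hz, hzJ⟩ := exists_eq_rightIdeal_toT α hx hJ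
  refine ⟨z, hz, ⟨(LinearEquiv.symm (LinearMap.quotKerEquivOfSurjective _
    (orbitMap_surjective (D := SRing α) hv))).trans (Submodule.quotEquivOfEq _ _ ?_)⟩⟩
  ext s
  rw [LinearMap.mem_ker, orbitMap_apply, ← hmem, hzJ, toT_mem_rightIdeal_iff hres α hx hz]

omit hres in
/-- `S`-linear maps between `T`-modules are `T`-linear, because the uniformizer is invertible in
`T`. -/
theorem nonempty_equiv_T_of_equiv_S {I J : Submodule (TRing α)ᵐᵒᵖ (TRing α)}
    (e : (TRing α ⧸ I) ≃ₗ[(SRing α)ᵐᵒᵖ] (TRing α ⧸ J)) :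
    Nonempty ((TRing α ⧸ I) ≃ₗ[(TRing α)ᵐᵒᵖ] (TRing α ⧸ J)) := by
  refine ⟨{ e with map_smul' := fun c q => ?_ }⟩
  obtain ⟨n, s, hs⟩ := exists_mul_pow_eq_toT α x hx c.unop
  have h : op (toT α (inS α x ^ n)) • e (c • q) = op (toT α (inS α x ^ n)) • c • e q := by
    have hc : op (toT α (inS α x ^ n)) * c = op (toT α s) := by
      rw [← hs, op_mul, op_unop, map_pow]
    rw [smul_smul, hc, ← op_smul_eq_op_toT_smul, ← op_smul_eq_op_toT_smul, ← map_smul, ← map_smul,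
      op_smul_eq_op_toT_smul, op_smul_eq_op_toT_smul, smul_smul, hc]
  have hu : IsUnit (op (toT α (inS α x ^ n))) := by
    rw [map_pow]
    exact ((isUnit_toT_inS α x (irreducible_uniformizer hx).ne_zero).pow n).op
  exact hu.smul_left_cancel.1 h

omit [IsDomain R] [IsDiscreteValuationRing R] hres hx in
theorem nonempty_equiv_S_of_equiv_T {I J : Submodule (TRing α)ᵐᵒᵖ (TRing α)}
    (e : (TRing α ⧸ I) ≃ₗ[(TRing α)ᵐᵒᵖ] (TRing α ⧸ J)) :
    Nonempty ((TRing α ⧸ I) ≃ₗ[(SRing α)ᵐᵒᵖ] (TRing α ⧸ J)) :=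
  ⟨{ e with map_smul' := fun c q => e.map_smul (op (toT α c.unop)) q }⟩

theorem nonempty_quotient_equiv_of_isSimpleModule {y : SRing α}
    (hy : y ∉ rightIdeal (inS α x))
    (h : IsSimpleModule (SRing α)ᵐᵒᵖ (TRing α ⧸ rightIdeal (toT α y))) :
    Nonempty ((SRing α ⧸ rightIdeal y) ≃ₗ[(SRing α)ᵐᵒᵖ] (TRing α ⧸ rightIdeal (toT α y))) := by
  refine nonempty_quotient_equiv_of_surjective hres α hx hy
    ((LinearMap.surjective_or_eq_zero _).resolve_right fun h0 => ?_)
  have h1 := LinearMap.congr_fun h0 (1 : SRing α)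
  have h2 : toT α 1 ∈ rightIdeal (toT α y) := (Submodule.Quotient.mk_eq_zero _).1 h1
  rw [map_one] at h2
  have h3 := IsSimpleModule.nontrivial (SRing α)ᵐᵒᵖ (TRing α ⧸ rightIdeal (toT α y))
  exact (Submodule.Quotient.nontrivial_iff.1 h3) (eq_top_of_one_mem h2)

end Setting

end

theorem mainTheorem4 {k : Type*} [Field k] {R : Type*} [CommRing R] [IsDomain R]
    [IsDiscreteValuationRing R] [Algebra k R]
    (hres : Function.Bijective (algebraMap k (IsLocalRing.ResidueField R)))
    (x : R) (hx : IsLocalRing.maximalIdeal R = Ideal.span {x})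
    (α : R ≃ₐ[k] R) (hα : ∀ n : ℕ, 0 < n → α ^ n ≠ 1) :
    -- (1)
    (∀ (V : Type*) [AddCommGroup V] [Module (SRing α)ᵐᵒᵖ V],
      IsSimpleModule (SRing α)ᵐᵒᵖ V → FaithfulSMul (SRing α)ᵐᵒᵖ V →
      (∃ z : SRing α, Irreducible z ∧ Irreducible (toT α z) ∧
        Nonempty (V ≃ₗ[(SRing α)ᵐᵒᵖ] (SRing α ⧸ rightIdeal z)) ∧
        Nonempty ((SRing α ⧸ rightIdeal z) ≃ₗ[(SRing α)ᵐᵒᵖ] (TRing α ⧸ rightIdeal (toT α z)))) ∧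
      (∀ z : SRing α,
        Nonempty (V ≃ₗ[(SRing α)ᵐᵒᵖ] (SRing α ⧸ rightIdeal z)) →
        Nonempty ((SRing α ⧸ rightIdeal z) ≃ₗ[(SRing α)ᵐᵒᵖ] (TRing α ⧸ rightIdeal (toT α z))) →
        IsTypeB α x z)) ∧
    -- (2)
    (∀ z : SRing α, Irreducible z → Irreducible (toT α z) → IsTypeB α x z →
      Nonempty ((SRing α ⧸ rightIdeal z) ≃ₗ[(SRing α)ᵐᵒᵖ] (TRing α ⧸ rightIdeal (toT α z))) ∧
      IsSimpleModule (SRing α)ᵐᵒᵖ (SRing α ⧸ rightIdeal z) ∧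
      FaithfulSMul (SRing α)ᵐᵒᵖ (SRing α ⧸ rightIdeal z)) ∧
    -- (3)
    (∀ z : SRing α, Irreducible z → Irreducible (toT α z) → IsTypeB α x z →
      ∀ y : SRing α, y ∉ rightIdeal (inS α x) →
      [Nonempty ((SRing α ⧸ rightIdeal z) ≃ₗ[(SRing α)ᵐᵒᵖ] (SRing α ⧸ rightIdeal y)),
        Nonempty ((TRing α ⧸ rightIdeal (toT α z)) ≃ₗ[(TRing α)ᵐᵒᵖ]
          (TRing α ⧸ rightIdeal (toT α y))),
        IsSimilar (toT α z) (toT α y)].TFAE ∧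
      (Nonempty ((SRing α ⧸ rightIdeal z) ≃ₗ[(SRing α)ᵐᵒᵖ] (SRing α ⧸ rightIdeal y)) →
        IsTypeB α x y)) ∧
    -- (4)
    (∀ (V : Type*) [AddCommGroup V] [Module (SRing α)ᵐᵒᵖ V],
      ((IsSimpleModule (SRing α)ᵐᵒᵖ V ∧ ¬ FaithfulSMul (SRing α)ᵐᵒᵖ V) ↔
        (IsSimpleModule (SRing α)ᵐᵒᵖ V ∧ IsXTorsion α x V)) ∧
      ((IsSimpleModule (SRing α)ᵐᵒᵖ V ∧ ¬ FaithfulSMul (SRing α)ᵐᵒᵖ V) ↔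
        ∃ f : Polynomial k, f.Monic ∧ Irreducible f ∧
          Nonempty (V ≃ₗ[(SRing α)ᵐᵒᵖ] VMod α x f))) ∧
    (∀ f g : Polynomial k, f.Monic → Irreducible f → g.Monic → Irreducible g →
      (Nonempty (VMod α x f ≃ₗ[(SRing α)ᵐᵒᵖ] VMod α x g) ↔ f = g)) := by
  refine ⟨fun V _ _ hs hf => ⟨?_, ?_⟩, fun z _ hzT hzB => ?_, fun z hz hzT hzB y hy => ?_,
    fun V _ _ => ⟨?_, ?_⟩, fun f g hf hf' hg hg' => nonempty_VMod_equiv_iff α hres hx hf hg hg' hf'⟩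
  · obtain ⟨z, hzx, ⟨e⟩⟩ := exists_quotient_equiv_of_faithfulSMul α hres hx hf
    obtain ⟨hirr, hu⟩ := irreducible_and_isUnit_red_of_faithfulSMul α hres hx
      (IsSimpleModule.congr e.symm) (faithfulSMul_of_equiv e hf)
    refine ⟨z, hirr, irreducible_of_isCoatom ?_ (isCoatom_rightIdeal_toT α hres hx hzx ?_), ⟨e⟩,
      nonempty_quotient_equiv_of_isUnit_red hres α hx hu⟩
    · exact (map_ne_zero_iff _ (toT_injective α)).2 hirr.ne_zero
    · exact quotient_isSimpleModule_iff.1 (IsSimpleModule.congr e.symm)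
  · rintro z ⟨e⟩ -
    obtain ⟨hirr, hu⟩ := irreducible_and_isUnit_red_of_faithfulSMul α hres hx
      (IsSimpleModule.congr e.symm) (faithfulSMul_of_equiv e hf)
    exact isTypeB_of_isUnit_red hres α hx hirr hu
  · have hu := hzB.isUnit_red hres α hx
    exact ⟨nonempty_quotient_equiv_of_isUnit_red hres α hx hu,
      isSimpleModule_quotient α hres hx hu hzT, faithfulSMul_quotient α hres hx hα hu hzT⟩
  · have hu := hzB.isUnit_red hres α hx
    have hs := isSimpleModule_quotient α hres hx hu hzT
    have hf := faithfulSMul_quotient α hres hx hα hu hzT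
    obtain ⟨ez⟩ := nonempty_quotient_equiv_of_isUnit_red hres α hx hu
    have hydata (e : (SRing α ⧸ rightIdeal z) ≃ₗ[(SRing α)ᵐᵒᵖ] (SRing α ⧸ rightIdeal y)) :=
      irreducible_and_isUnit_red_of_faithfulSMul α hres hx
        (IsSimpleModule.congr e.symm) (faithfulSMul_of_equiv e hf)
    refine ⟨?_, fun ⟨e⟩ => isTypeB_of_isUnit_red hres α hx (hydata e).1 (hydata e).2⟩
    tfae_have 1 → 2 := by
      rintro ⟨e⟩
      obtain ⟨ey⟩ := nonempty_quotient_equiv_of_isUnit_red hres α hx (hydata e).2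
      exact nonempty_equiv_T_of_equiv_S α hx ((ez.symm.trans e).trans ey)
    tfae_have 2 → 1 := by
      rintro ⟨e⟩
      obtain ⟨e'⟩ := nonempty_equiv_S_of_equiv_T α e
      obtain ⟨ey⟩ := nonempty_quotient_equiv_of_isSimpleModule α hres hx hy
        (IsSimpleModule.congr (ez.trans e').symm)
      exact ⟨(ez.trans e').trans ey.symm⟩
    tfae_have 2 ↔ 3 := nonempty_quotient_equiv_iff_isSimilar hzT.not_isUnit
    tfae_finish
  · exact and_congr_right fun _ => not_faithfulSMul_iff_isXTorsion α hx hα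
  · constructor
    · rintro ⟨hs, hf⟩
      exact exists_VMod_equiv α hres hx (uniformizer_smul_eq_zero_of_not_faithfulSMul α hx hα hf)
    · rintro ⟨f, -, hf, ⟨e⟩⟩
      have := isSimpleModule_VMod α hres hx hf
      exact ⟨IsSimpleModule.congr e, fun h => not_faithfulSMul_of_uniformizer_smul_eq_zero α hx
        (uniformizer_smul_VMod α hres hx f) (faithfulSMul_of_equiv e h)⟩
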